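/- Let $\mathbb{D}^2=\{z\in\mathbb{C}^2: |z_1|<1,\ |z_2|<1\}$, let $\mathbb{T}^2$ be its distinguished boundary with normalized Lebesgue measure, and let $H^2=H^2(\mathbb{D}^2)$ be the Hardy space, identified through boundary values with a closed subspace of $L^2(\mathbb{T}^2)$; let $H^2_2\subset H^2$ be the closed subspace of functions of $z_2$ only and $P_{H^2_2}$ the orthogonal projection of $L^2(\mathbb{T}^2)$ onto it. An inner function is a bounded holomorphic function on $\mathbb{D}^2$ whose non-tangential limits exist and are unimodular a.e. on $\mathbb{T}^2$. For an inner function $\phi$ put $K_\phi=H^2\ominus\phi H^2$, let $P_\phi$ be the orthogonal projection onto $K_\phi$, and let $S^1_\phi f=P_\phi(z_1f)$ for $f\in K_\phi$. Write $$k_w(z)=\frac{1}{(1-z_1\bar w_1)(1-z_2\bar w_2)},\qquad k^\phi_w(z)=(1-\phi(z)\overline{\phi(w)})\,k_w(z).$$ For $\alpha\in\mathbb{T}$ let $\sigma_\alpha$ be the Clark measure, the finite positive Borel measure on $\mathbb{T}^2$ with $$\frac{1-|\phi(z)|^2}{|\alpha-\phi(z)|^2}=\int_{\mathbb{T}^2}\frac{1-|z_1|^2}{|\zeta_1-z_1|^2}\,\frac{1-|z_2|^2}{|\zeta_2-z_2|^2}\,d\sigma_\alpha(\zeta),\qquad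 z\in\mathbb{D}^2,$$ and let $J_\alpha:K_\phi\to L^2(\sigma_\alpha)$ be the Clark embedding, the continuous linear map with $J_\alpha k^\phi_w=(1-\alpha\overline{\phi(w)})\,k_w$ for all $w\in\mathbb{D}^2$. Let $$\mathbf{1}_\alpha(z)=\bar\alpha\,\frac{(B_1\phi)(z)}{1-\bar\alpha\phi(0,z_2)},\qquad (B_1\phi)(z)=\frac{\phi(z)-\phi(0,z_2)}{z_1},$$ where the quotient $B_1\phi$ is extended holomorphically to $z_1=0$. When $\mathbf{1}_\alpha$ is bounded, let $$U^1_\alpha=S^1_\phi+P_\phi P_{H^2_2}M_{\overline{\mathbf{1}_\alpha}}\quad\text{on } K_\phi,$$ where $M_{\overline{\mathbf{1}_\alpha}}$ is multiplication by the conjugate of the boundary function of $\mathbf{1}_\alpha$. **Statement.** Let $\phi$ be inner on $\mathbb{D}^2$ and $\alpha\in\mathbb{T}$. Assume that $J_\alpha$ is surjective, that $\mathbf{1}_\alpha$ is bounded on $\mathbb{D}^2$, and that $\phi(0,z_2)\equiv0$. Then $\phi=z_1\psi$ for some inner function $\psi$, and the following hold. 1. $K_\phi=K_\psi\oplus\psi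 H^2_2$ (orthogonal direct sum). In particular, each $f\in K_\phi$ can be written uniquely as $f=f_1+\psi f_2$ with $f_1\in K_\psi$ and $f_2\in H^2_2$. 2. For $f=f_1+\psi f_2$ written in this way, $U^1_\alpha f=z_1f_1+\alpha f_2$. 3. $U^1_\alpha$ is unitary on $K_\phi$; if $M_{z_1}$ denotes multiplication by $\zeta_1$ on $L^2(\sigma_\alpha)$, then $M_{z_1}=J_\alpha U^1_\alpha J_\alpha^*$ and $U^1_\alpha=J_\alpha^*M_{z_1}J_\alpha$. Moreover, $U^1_\alpha-S^1_\phi$ has infinite rank. -/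

import Mathlib

open MeasureTheory Filter Topology Set
open scoped ComplexConjugate ENNReal InnerProductSpace

noncomputable section

/-- The open unit bidisk. -/
def bidisk : Set (ℂ × ℂ) := {z | ‖z.1‖ < 1 ∧ ‖z.2‖ < 1}

/-- The two-torus, parametrized by angles modulo `1`. Its `volume` is normalized Lebesgue measure. -/
abbrev Torus : Type := UnitAddCircle × UnitAddCircle

/-- The point `(exp (2πi θ₁), exp (2πi θ₂))` of the distinguished boundary of the bidisk. -/
def torusPt (θ : Torus) : ℂ × ℂ := (AddCircle.toCircle θ.1, AddCircle.toCircle θ.2)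

theorem continuous_torusPt : Continuous torusPt := by
  unfold torusPt
  have h := AddCircle.continuous_toCircle (T := (1 : ℝ))
  exact (continuous_subtype_val.comp (h.comp continuous_fst)).prodMk
    (continuous_subtype_val.comp (h.comp continuous_snd))

/-- `L²` of the torus with normalized Lebesgue measure. -/
abbrev L2Torus : Type := Lp ℂ 2 (volume : Measure Torus)

/-- The non-tangential approach region of aperture `κ` at `ζ` (norms are maximum norms). -/
def approachRegion (κ : ℝ) (ζ : ℂ × ℂ) : Set (ℂ × ℂ) :=
  {z ∈ bidisk | ‖ζ - z‖ < κ * (1 - ‖z‖)}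

/-- `g` has the non-tangential limit `c` at the point `ζ` of the torus. -/
def HasNontangentialLimit (g : ℂ × ℂ → ℂ) (ζ : ℂ × ℂ) (c : ℂ) : Prop :=
  ∀ κ : ℝ, Tendsto g (𝓝[approachRegion κ ζ] ζ) (𝓝 c)

/-- Inner functions on the bidisk. -/
structure IsInner (φ : ℂ × ℂ → ℂ) : Prop where
  differentiableOn : DifferentiableOn ℂ φ bidisk
  bounded : ∃ C : ℝ, ∀ z ∈ bidisk, ‖φ z‖ ≤ C
  unimodular : ∀ᵐ θ : Torus, ∃ c : ℂ, ‖c‖ = 1 ∧ HasNontangentialLimit φ (torusPt θ) c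

/-- The radial boundary function of `g`. -/
def radialLimit (g : ℂ × ℂ → ℂ) (θ : Torus) : ℂ :=
  limUnder (𝓝[<] (1 : ℝ)) fun r => g ((r : ℂ) • torusPt θ)

/-- The Szegő kernel `k_w(z)` of the bidisk. -/
def szego (w z : ℂ × ℂ) : ℂ := 1 / ((1 - z.1 * conj w.1) * (1 - z.2 * conj w.2))

/-- The monomial `ζ₁ ^ m * ζ₂ ^ n` as an element of `L²` of the torus. -/
def monomialL2 (m n : ℕ) : L2Torus :=
  ContinuousMap.toLp 2 volume ℂ
    ⟨fun θ : Torus => (torusPt θ).1 ^ m * (torusPt θ).2 ^ n, by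
      have := continuous_torusPt
      fun_prop⟩

/-- The Hardy space `H²(𝔻²)`, identified with the closed subspace of `L²(𝕋²)` of boundary values,
that is, of the square-summable series `∑ a_{m,n} ζ₁ ^ m ζ₂ ^ n` with `m, n ≥ 0`. -/
def hardy : Submodule ℂ L2Torus :=
  (Submodule.span ℂ (range fun p : ℕ × ℕ => monomialL2 p.1 p.2)).topologicalClosure

/-- The Hardy space `H²₂` of the functions in `H²(𝔻²)` that depend on `z₂` only. -/
def hardyTwo : Submodule ℂ L2Torus :=
  (Submodule.span ℂ (range fun n : ℕ => monomialL2 0 n)).topologicalClosure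

/-- The value at `z ∈ 𝔻²` of the holomorphic function that corresponds to `f ∈ H²(𝔻²)`, given by
the Cauchy integral of the boundary values. -/
def hardyEval (f : L2Torus) (z : ℂ × ℂ) : ℂ := ∫ θ : Torus, f θ * szego (torusPt θ) z

theorem integrable_mul_szego (f : L2Torus) {z : ℂ × ℂ} (hz : z ∈ bidisk) :
    Integrable (fun θ : Torus => f θ * szego (torusPt θ) z) := by
  have aux : ∀ (a b : ℂ), ‖a‖ < 1 → ‖b‖ = 1 → 1 - a * conj b ≠ 0 := by
    intro a b ha hb h
    have h1 : a * conj b = 1 := (sub_eq_zero.mp h).symm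
    have h2 : ‖a * conj b‖ = 1 := by rw [h1]; simp
    rw [norm_mul, RCLike.norm_conj, hb, mul_one] at h2
    linarith
  have hc : Continuous fun θ : Torus => szego (torusPt θ) z := by
    unfold szego
    have hp := continuous_torusPt
    refine continuous_const.div (by fun_prop) fun θ => mul_ne_zero ?_ ?_
    · exact aux _ _ hz.1 (Circle.norm_coe _)
    · exact aux _ _ hz.2 (Circle.norm_coe _)
  obtain ⟨C, hC⟩ := isCompact_univ.exists_bound_of_continuousOn hc.continuousOn
  have hf : Integrable (fun θ : Torus => f θ) := (Lp.memLp f).integrable (by norm_num)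
  exact hf.mul_bdd hc.aestronglyMeasurable (Eventually.of_forall fun θ => hC θ (mem_univ θ))

theorem hardyEval_add (f g : L2Torus) {z : ℂ × ℂ} (hz : z ∈ bidisk) :
    hardyEval (f + g) z = hardyEval f z + hardyEval g z := by
  unfold hardyEval
  rw [← integral_add (integrable_mul_szego f hz) (integrable_mul_szego g hz)]
  refine integral_congr_ae ?_
  filter_upwards [Lp.coeFn_add f g] with θ h
  rw [h, Pi.add_apply, add_mul]

theorem hardyEval_smul (c : ℂ) (f : L2Torus) (z : ℂ × ℂ) :
    hardyEval (c • f) z = c * hardyEval f z := by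
  unfold hardyEval
  rw [← integral_const_mul]
  refine integral_congr_ae ?_
  filter_upwards [Lp.coeFn_smul c f] with θ h
  rw [h, Pi.smul_apply, smul_eq_mul, mul_assoc]

/-- The subspace `φ M = {φ f : f ∈ M}` of `H²(𝔻²)`; products are taken on the bidisk. -/
def mulSubspace (φ : ℂ × ℂ → ℂ) (M : Submodule ℂ L2Torus) : Submodule ℂ L2Torus where
  carrier := {g | g ∈ hardy ∧ ∃ f ∈ M, ∀ z ∈ bidisk, hardyEval g z = φ z * hardyEval f z}
  add_mem' := by
    rintro g g' ⟨hg, f, hf, h⟩ ⟨hg', f', hf', h'⟩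
    refine ⟨add_mem hg hg', f + f', add_mem hf hf', fun z hz => ?_⟩
    rw [hardyEval_add _ _ hz, hardyEval_add _ _ hz, h z hz, h' z hz, mul_add]
  zero_mem' := by
    refine ⟨zero_mem _, 0, zero_mem _, fun z _ => ?_⟩
    have : hardyEval 0 z = 0 := by simpa using hardyEval_smul 0 0 z
    rw [this, mul_zero]
  smul_mem' := by
    rintro c g ⟨hg, f, hf, h⟩
    refine ⟨Submodule.smul_mem _ c hg, c • f, Submodule.smul_mem _ c hf, fun z hz => ?_⟩
    rw [hardyEval_smul, hardyEval_smul, h z hz, mul_left_comm]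

/-- The model space `K_φ = H²(𝔻²) ⊖ φ H²(𝔻²)`. -/
def modelSpace (φ : ℂ × ℂ → ℂ) : Submodule ℂ L2Torus := hardy ⊓ (mulSubspace φ hardy)ᗮ

instance instCompleteSpaceHardyTwo : CompleteSpace hardyTwo :=
  (Submodule.isClosed_topologicalClosure _).completeSpace_coe

instance instCompleteSpaceModelSpace (φ : ℂ × ℂ → ℂ) : CompleteSpace (modelSpace φ) :=
  ((Submodule.isClosed_topologicalClosure _).inter
    (Submodule.isClosed_orthogonal _)).completeSpace_coe

open Classical in
/-- Multiplication by an essentially bounded function `b` on `L²(μ)` (zero if `b` is not in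
`L^∞(μ)`). -/
def mulLp (μ : Measure Torus) (b : Torus → ℂ) : Lp ℂ 2 μ →L[ℂ] Lp ℂ 2 μ :=
  if h : MemLp b ∞ μ then (ContinuousLinearMap.mul ℂ ℂ).holderL μ ∞ 2 2 (h.toLp b) else 0

/-- Multiplication `M_{z₁}` by the first coordinate function on `L²(μ)`. -/
def mulZ1 (μ : Measure Torus) : Lp ℂ 2 μ →L[ℂ] Lp ℂ 2 μ := mulLp μ fun θ => (torusPt θ).1

/-- The compressed shift `S¹_φ f = P_{K_φ} (z₁ f)` on `K_φ`. -/
def compressedShift (φ : ℂ × ℂ → ℂ) : modelSpace φ →L[ℂ] modelSpace φ :=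
  (modelSpace φ).orthogonalProjectionOnto ∘L mulZ1 volume ∘L (modelSpace φ).subtypeL

/-- The backward shift `(B₁ f)(z) = (f(z) - f(0, z₂)) / z₁`, with the derivative in the first
variable as its value at `z₁ = 0`. -/
def backwardShift (f : ℂ × ℂ → ℂ) (z : ℂ × ℂ) : ℂ := dslope (fun s => f (s, z.2)) 0 z.1

/-- The function `𝟏_α = conj α * B₁ φ / (1 - conj α * φ(0, z₂))` on the bidisk. -/
def oneAlpha (φ : ℂ × ℂ → ℂ) (α : ℂ) (z : ℂ × ℂ) : ℂ :=
  conj α * (backwardShift φ z / (1 - conj α * φ (0, z.2)))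

/-- The operator `U¹_α = S¹_φ + P_φ P_{H²₂} M_{conj 𝟏_α}` on `K_φ`. -/
def clarkUnitary (φ : ℂ × ℂ → ℂ) (α : ℂ) : modelSpace φ →L[ℂ] modelSpace φ :=
  compressedShift φ + (modelSpace φ).orthogonalProjectionOnto ∘L hardyTwo.starProjection ∘L
    mulLp volume (radialLimit fun z => conj (oneAlpha φ α z)) ∘L (modelSpace φ).subtypeL

/-- The Poisson kernel `P_z(ζ)` of the unit disk. -/
def poissonDisk (z ζ : ℂ) : ℝ := (1 - ‖z‖ ^ 2) / ‖ζ - z‖ ^ 2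

/-- `σ` is the Clark measure of `φ` at `α`. -/
structure IsClarkMeasure (φ : ℂ × ℂ → ℂ) (α : ℂ) (σ : Measure Torus) : Prop where
  finite : IsFiniteMeasure σ
  poisson : ∀ z ∈ bidisk, (1 - ‖φ z‖ ^ 2) / ‖α - φ z‖ ^ 2 =
    ∫ θ, poissonDisk z.1 (torusPt θ).1 * poissonDisk z.2 (torusPt θ).2 ∂σ

/-- `J` takes the reproducing kernel `k_w^φ(z) = (1 - φ(z) conj φ(w)) k_w(z)` of `K_φ` to the
function `(1 - α conj φ(w)) k_w`, for all `w` in the bidisk. -/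
def IsClarkEmbedding (φ : ℂ × ℂ → ℂ) (α : ℂ) (σ : Measure Torus)
    (J : modelSpace φ →L[ℂ] Lp ℂ 2 σ) : Prop :=
  ∀ w ∈ bidisk, ∃ k : modelSpace φ,
    (∀ z ∈ bidisk, hardyEval k z = (1 - φ z * conj (φ w)) * szego w z) ∧
    J k =ᵐ[σ] fun θ => (1 - α * conj (φ w)) * szego w (torusPt θ)

open Classical in
/-- The Clark embedding `J_α : K_φ → L²(σ)`: the continuous linear map with the prescribed values
on the reproducing kernels, which span a dense subspace of `K_φ`. -/
def clarkEmbedding (φ : ℂ × ℂ → ℂ) (α : ℂ) (σ : Measure Torus) :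
    modelSpace φ →L[ℂ] Lp ℂ 2 σ :=
  if h : ∃ J, IsClarkEmbedding φ α σ J then h.choose else 0

end

/-! ### The Cauchy formula on the circle and on the torus -/

/-! Since `φ` vanishes on `z₁ = 0`, it factors as `z₁ψ`, and then `𝟏_α = conj α * ψ`: its
boundedness bounds `ψ`, and dividing the non-tangential limits of `φ` by `ζ₁` shows that `ψ` is
inner (`IsInner.exists_eq_mul`).

Multiplication by an inner function is isometric on `L²`, and `H² = H²₂ ⊕ z₁H²`. Hence `ψH² = ψH²₂ ⊕
φH²`, which gives `K_φ = K_ψ ⊕ ψH²₂` (`modelSpace_sup_mulSubspace`). For `f = f₁ + ψf₂`, the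
function `z₁f₁` stays in `K_φ`, while `z₁ψf₂ = φf₂` is killed by the projection, so `S¹_φ f = z₁f₁`.
On the torus `conj 𝟏_α = α conj ψ`. As `f₁ ⟂ ψH²₂`, projecting `α conj ψ f` to `H²₂` leaves `αf₂`,
and `H²₂ ⊆ K_φ`. This is the formula for `U¹_α` (`coe_clarkUnitary`); the difference `U¹_α - S¹_φ`
is `f ↦ αf₂`, whose range is all of `H²₂`.

The Clark part is tested on reproducing kernels. The Poisson identity defining `σ` gives the norms
of the Szegő kernels in `L²(σ)`; polarization by the identity theorem gives all their inner products
(`IsClarkMeasure.integral_szego_mul_szego`), whence `J* J = 1`. Surjectivity makes `J` unitary. On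
kernels, `conj w₁ U k_w^φ = k_w^φ - (1 - α conj φ(w)) k_{(0,w₂)}`, and `J` turns this into the
identity `conj w₁ ζ₁ k_w = k_w - k_{(0,w₂)}`; thus `J U = M_{z₁} J`
(`IsClarkEmbedding.comp_clarkUnitary`). So `U` is unitarily equivalent to the unitary `M_{z₁}`.

The rest identifies elements of `hardy`, defined as a closed span of monomials, with holomorphic
functions through the Cauchy integral `hardyEval`. -/

theorem integral_unitAddCircle_toCircle (f : ℂ → ℂ) :
    ∫ θ : UnitAddCircle, f (AddCircle.toCircle θ) = Real.circleAverage f 0 1 := by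
  rw [← UnitAddCircle.intervalIntegral_preimage 0, Real.circleAverage_def]
  have h := intervalIntegral.smul_integral_comp_mul_left (a := 0) (b := 0 + 1)
    (fun θ => f (circleMap 0 1 θ)) (2 * Real.pi)
  have h2 : (2 * Real.pi) ≠ 0 := by positivity
  simp only [mul_zero, zero_add, mul_one] at h
  rw [← h, inv_smul_smul₀ h2]
  simp only [zero_add]
  congr 1
  ext x
  rw [AddCircle.toCircle_apply_mk, circleMap, Circle.coe_exp]
  simp

/-- On the unit circle `ζ / (ζ - z) = 1 / (1 - z conj ζ)`, so this is the usual Cauchy formula. -/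
theorem integral_circle_cauchy {g : ℂ → ℂ} (hg : DiffContOnCl ℂ g (Metric.ball 0 1)) {z : ℂ}
    (hz : ‖z‖ < 1) :
    ∫ θ : UnitAddCircle, g (AddCircle.toCircle θ) / (1 - z * conj (AddCircle.toCircle θ : ℂ)) =
      g z := by
  have h := DiffContOnCl.circleAverage_smul_div (c := 0) (R := 1) (f := g) (w := z)
    (by simpa using hg) (by simpa using hz)
  rw [← h, ← integral_unitAddCircle_toCircle]
  congr 1
  ext θ
  set ζ : ℂ := (AddCircle.toCircle θ : ℂ)
  have h1 : ζ * conj ζ = 1 := by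
    rw [Complex.mul_conj, Complex.normSq_eq_norm_sq, Circle.norm_coe]; simp
  have hζ : ζ ≠ 0 := fun h0 => by simp [h0] at h1
  have h3 : ζ - z ≠ 0 := fun h0 => by
    have : ‖ζ‖ = ‖z‖ := by rw [sub_eq_zero.mp h0]
    rw [Circle.norm_coe] at this
    linarith
  have h2 : conj ζ = ζ⁻¹ := eq_inv_of_mul_eq_one_right h1
  rw [h2, sub_zero, smul_eq_mul]
  have h4 : 1 - z * ζ⁻¹ ≠ 0 := fun h0 => h3 (by field_simp at h0; simpa using h0)
  field_simp

theorem isOpen_bidisk : IsOpen bidisk :=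
  (isOpen_lt continuous_fst.norm continuous_const).inter
    (isOpen_lt continuous_snd.norm continuous_const)

theorem norm_torusPt_fst (θ : Torus) : ‖(torusPt θ).1‖ = 1 := Circle.norm_coe _

theorem norm_torusPt_snd (θ : Torus) : ‖(torusPt θ).2‖ = 1 := Circle.norm_coe _

theorem one_sub_mul_conj_ne_zero {a b : ℂ} (ha : ‖a‖ < 1) (hb : ‖b‖ ≤ 1) :
    1 - a * conj b ≠ 0 := fun h => by
  have h2 : ‖a * conj b‖ = 1 := by rw [(sub_eq_zero.mp h).symm]; simp
  rw [norm_mul, RCLike.norm_conj] at h2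
  nlinarith [norm_nonneg a, norm_nonneg b]

theorem continuousOn_szego :
    ContinuousOn (fun p : (ℂ × ℂ) × (ℂ × ℂ) => szego p.1 p.2)
      ({w | ‖w.1‖ ≤ 1 ∧ ‖w.2‖ ≤ 1} ×ˢ bidisk) := by
  unfold szego
  refine continuousOn_const.div (by fun_prop) fun p hp => mul_ne_zero ?_ ?_
  · exact one_sub_mul_conj_ne_zero hp.2.1 hp.1.1
  · exact one_sub_mul_conj_ne_zero hp.2.2 hp.1.2

theorem conj_szego (w z : ℂ × ℂ) : conj (szego w z) = szego z w := by
  simp only [szego, map_div₀, map_one, map_mul, map_sub, Complex.conj_conj]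
  rw [mul_comm (conj z.1), mul_comm (conj z.2)]

theorem smul_mem_bidisk {r : ℝ} (h0 : 0 ≤ r) (h1 : r < 1) {z : ℂ × ℂ} (hz1 : ‖z.1‖ ≤ 1)
    (hz2 : ‖z.2‖ ≤ 1) : (r : ℂ) • z ∈ bidisk := by
  constructor <;> simp only [Prod.smul_fst, Prod.smul_snd, norm_smul, Complex.norm_real,
    Real.norm_of_nonneg h0] <;> nlinarith

theorem smul_torusPt_mem_bidisk {r : ℝ} (h0 : 0 ≤ r) (h1 : r < 1) (θ : Torus) :
    (r : ℂ) • torusPt θ ∈ bidisk :=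
  smul_mem_bidisk h0 h1 (norm_torusPt_fst θ).le (norm_torusPt_snd θ).le

theorem continuous_smul_torusPt (r : ℝ) : Continuous fun θ => (r : ℂ) • torusPt θ :=
  continuous_torusPt.const_smul (r : ℂ)

theorem integrable_of_continuous_torus {μ : Measure Torus} [IsFiniteMeasure μ] {f : Torus → ℂ}
    (hf : Continuous f) : Integrable f μ := by
  rw [← integrableOn_univ]
  exact hf.continuousOn.integrableOn_compact isCompact_univ

theorem continuous_szego_torusPt {z : ℂ × ℂ} (hz : z ∈ bidisk) :
    Continuous fun θ : Torus => szego (torusPt θ) z := by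
  exact continuousOn_szego.comp_continuous (f := fun θ : Torus => (torusPt θ, z))
    (continuous_torusPt.prodMk continuous_const)
    fun θ => ⟨⟨(norm_torusPt_fst θ).le, (norm_torusPt_snd θ).le⟩, hz⟩

/-- Cauchy's formula in each variable in turn; dilating by `r < 1` makes the slices holomorphic up
to the closed disk. -/
theorem integral_torus_cauchy {g : ℂ × ℂ → ℂ} (hg : DifferentiableOn ℂ g bidisk) {r : ℝ}
    (h0 : 0 ≤ r) (h1 : r < 1) {z : ℂ × ℂ} (hz : z ∈ bidisk) :
    ∫ θ : Torus, g ((r : ℂ) • torusPt θ) * szego (torusPt θ) z = g ((r : ℂ) • z) := by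
  have hc : Continuous fun θ : Torus => g ((r : ℂ) • torusPt θ) * szego (torusPt θ) z :=
    (hg.continuousOn.comp_continuous (continuous_smul_torusPt r)
      (smul_torusPt_mem_bidisk h0 h1)).mul (continuous_szego_torusPt hz)
  rw [Measure.volume_eq_prod, integral_prod _ (by
    rw [← Measure.volume_eq_prod]; exact integrable_of_continuous_torus hc)]
  have hslice1 : ∀ a : ℂ, ‖a‖ ≤ 1 →
      DiffContOnCl ℂ (fun s => g ((r : ℂ) * a, (r : ℂ) * s)) (Metric.ball 0 1) := by
    intro a ha
    refine DifferentiableOn.diffContOnCl (DifferentiableOn.comp hg (by fun_prop) fun s hs => ?_)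
    rw [closure_ball _ one_ne_zero, mem_closedBall_zero_iff] at hs
    exact smul_mem_bidisk (z := (a, s)) h0 h1 ha hs
  have hslice2 : DiffContOnCl ℂ (fun s => g ((r : ℂ) * s, (r : ℂ) * z.2)) (Metric.ball 0 1) := by
    refine DifferentiableOn.diffContOnCl (DifferentiableOn.comp hg (by fun_prop) fun s hs => ?_)
    rw [closure_ball _ one_ne_zero, mem_closedBall_zero_iff] at hs
    exact smul_mem_bidisk (z := (s, z.2)) h0 h1 hs hz.2.le
  have h3 := integral_circle_cauchy hslice2 hz.1
  simp only [Prod.smul_def, smul_eq_mul] at h3 ⊢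
  rw [← h3]
  congr 1
  ext x
  rw [← integral_circle_cauchy (hslice1 _ (Circle.norm_coe (AddCircle.toCircle x)).le) hz.2,
    ← integral_div]
  congr 1
  ext y
  simp only [torusPt, szego]
  rw [mul_one_div, div_div, mul_comm (1 - _)]

/-! ### Cauchy kernels in the algebra of continuous functions on the torus -/

/-- The first coordinate as a continuous function on the torus. -/
noncomputable def coordOne : C(Torus, ℂ) := ⟨fun θ => (torusPt θ).1, continuous_torusPt.fst⟩

/-- The second coordinate as a continuous function on the torus. -/
noncomputable def coordTwo : C(Torus, ℂ) := ⟨fun θ => (torusPt θ).2, continuous_torusPt.snd⟩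

theorem norm_coordOne_le : ‖coordOne‖ ≤ 1 :=
  (ContinuousMap.norm_le _ zero_le_one).mpr fun θ => (norm_torusPt_fst θ).le

theorem norm_coordTwo_le : ‖coordTwo‖ ≤ 1 :=
  (ContinuousMap.norm_le _ zero_le_one).mpr fun θ => (norm_torusPt_snd θ).le

theorem norm_star_coordOne_le : ‖star coordOne‖ ≤ 1 :=
  (ContinuousMap.norm_le _ zero_le_one).mpr fun θ => by
    simpa [coordOne] using (norm_torusPt_fst θ).le

theorem norm_star_coordTwo_le : ‖star coordTwo‖ ≤ 1 :=
  (ContinuousMap.norm_le _ zero_le_one).mpr fun θ => by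
    simpa [coordTwo] using (norm_torusPt_snd θ).le

/-- The function `1 / ((1 - w₁ a) (1 - w₂ b))` on the torus. -/
noncomputable def cauchyMap (a b : C(Torus, ℂ)) (w : ℂ × ℂ) : C(Torus, ℂ) :=
  Ring.inverse (1 - w.1 • a) * Ring.inverse (1 - w.2 • b)

theorem norm_smul_lt_one {E : Type*} [NormedAddCommGroup E] [NormedSpace ℂ E] {a : E}
    (ha : ‖a‖ ≤ 1) {s : ℂ} (hs : ‖s‖ < 1) : ‖s • a‖ < 1 := by
  rw [norm_smul]; nlinarith [norm_nonneg a, norm_nonneg s]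

theorem ringInverse_one_sub_apply {x : C(Torus, ℂ)} (hx : ‖x‖ < 1) (θ : Torus) :
    Ring.inverse (1 - x) θ = (1 - x θ)⁻¹ := by
  have h := Ring.inverse_mul_cancel _ (isUnit_one_sub_of_norm_lt_one hx)
  have h2 : Ring.inverse (1 - x) θ * (1 - x θ) = 1 := by
    simpa using congrArg (fun f : C(Torus, ℂ) => f θ) h
  exact eq_inv_of_mul_eq_one_left h2

theorem cauchyMap_apply {a b : C(Torus, ℂ)} (ha : ‖a‖ ≤ 1) (hb : ‖b‖ ≤ 1) {w : ℂ × ℂ}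
    (hw : w ∈ bidisk) (θ : Torus) :
    cauchyMap a b w θ = 1 / ((1 - w.1 * a θ) * (1 - w.2 * b θ)) := by
  rw [cauchyMap, ContinuousMap.mul_apply, ringInverse_one_sub_apply (norm_smul_lt_one ha hw.1),
    ringInverse_one_sub_apply (norm_smul_lt_one hb hw.2)]
  simp [mul_comm]

/-- Inversion is holomorphic on the units of the Banach algebra `C(Torus, ℂ)`. The kernels thus
depend holomorphically on the parameter in the sup norm, and so does every continuous linear
functional of them. -/
theorem differentiableOn_cauchyMap {a b : C(Torus, ℂ)} (ha : ‖a‖ ≤ 1) (hb : ‖b‖ ≤ 1) :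
    DifferentiableOn ℂ (cauchyMap a b) bidisk := by
  intro w hw
  have h1 := differentiableAt_inverse (𝕜 := ℂ)
    (isUnit_one_sub_of_norm_lt_one (norm_smul_lt_one ha hw.1))
  have h2 := differentiableAt_inverse (𝕜 := ℂ)
    (isUnit_one_sub_of_norm_lt_one (norm_smul_lt_one hb hw.2))
  have h3 : DifferentiableAt ℂ (fun w : ℂ × ℂ => Ring.inverse (1 - w.1 • a)) w :=
    h1.comp w (f := fun w : ℂ × ℂ => 1 - w.1 • a) (by fun_prop)
  have h4 : DifferentiableAt ℂ (fun w : ℂ × ℂ => Ring.inverse (1 - w.2 • b)) w :=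
    h2.comp w (f := fun w : ℂ × ℂ => 1 - w.2 • b) (by fun_prop)
  exact (h3.mul h4).differentiableWithinAt

theorem conj_mem_bidisk {w : ℂ × ℂ} (hw : w ∈ bidisk) : (conj w.1, conj w.2) ∈ bidisk := by
  simpa [bidisk] using hw

theorem cauchyMap_coord_conj {w : ℂ × ℂ} (hw : w ∈ bidisk) (θ : Torus) :
    cauchyMap coordOne coordTwo (conj w.1, conj w.2) θ = szego w (torusPt θ) := by
  rw [cauchyMap_apply norm_coordOne_le norm_coordTwo_le (conj_mem_bidisk hw)]
  simp [szego, coordOne, coordTwo, mul_comm]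

theorem cauchyMap_star_coord {z : ℂ × ℂ} (hz : z ∈ bidisk) (θ : Torus) :
    cauchyMap (star coordOne) (star coordTwo) z θ = szego (torusPt θ) z := by
  rw [cauchyMap_apply norm_star_coordOne_le
    norm_star_coordTwo_le hz]
  simp [szego, coordOne, coordTwo]

/-- The integral is a continuous linear functional of `K w`, which avoids differentiation under the
integral sign; `star h` undoes the conjugation in the first slot of the inner product. -/
theorem ContinuousMap.differentiableOn_integral_comp {μ : Measure Torus} [IsFiniteMeasure μ]
    {E : Type*} [NormedAddCommGroup E] [NormedSpace ℂ E] {K : E → C(Torus, ℂ)} {s : Set E}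
    (hK : DifferentiableOn ℂ K s) (h : Lp ℂ 2 μ) :
    DifferentiableOn ℂ (fun w => ∫ θ, h θ * K w θ ∂μ) s := by
  have hd : DifferentiableOn ℂ (fun w => ⟪star h, ContinuousMap.toLp 2 μ ℂ (K w)⟫_ℂ) s :=
    ((innerSL ℂ (star h)).comp (ContinuousMap.toLp 2 μ ℂ)).differentiable.comp_differentiableOn hK
  refine hd.congr fun w _ => ?_
  rw [L2.inner_def]
  refine integral_congr_ae ?_
  filter_upwards [Lp.coeFn_star h, ContinuousMap.coeFn_toLp (p := 2) (𝕜 := ℂ) μ (K w)] with θ h1 h2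
  rw [h2, RCLike.inner_apply, h1]
  simp [mul_comm]

theorem differentiableOn_hardyEval (h : L2Torus) : DifferentiableOn ℂ (hardyEval h) bidisk := by
  refine (ContinuousMap.differentiableOn_integral_comp
    (differentiableOn_cauchyMap (a := star coordOne) (b := star coordTwo)
      norm_star_coordOne_le norm_star_coordTwo_le)
    h).congr fun z hz => ?_
  simp only [hardyEval, cauchyMap_star_coord hz]

/-! ### Reproducing kernels -/

/-- The Szegő kernel `k_w` as an element of `L²` of the torus. -/
noncomputable def szegoL2 (w : ℂ × ℂ) : L2Torus :=
  ContinuousMap.toLp 2 volume ℂ (cauchyMap coordOne coordTwo (conj w.1, conj w.2))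

theorem coeFn_szegoL2 {w : ℂ × ℂ} (hw : w ∈ bidisk) :
    szegoL2 w =ᵐ[volume] fun θ => szego w (torusPt θ) := by
  refine (ContinuousMap.coeFn_toLp volume _).trans (Eventually.of_forall fun θ => ?_)
  exact cauchyMap_coord_conj hw θ

theorem inner_szegoL2 {w : ℂ × ℂ} (hw : w ∈ bidisk) (h : L2Torus) :
    ⟪szegoL2 w, h⟫_ℂ = hardyEval h w := by
  rw [L2.inner_def, hardyEval]
  refine integral_congr_ae ?_
  filter_upwards [coeFn_szegoL2 hw] with θ h1
  rw [h1, RCLike.inner_apply, conj_szego]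

theorem isClosed_hardy : IsClosed (hardy : Set L2Torus) := Submodule.isClosed_topologicalClosure _

theorem monomialL2_mem_hardy (m n : ℕ) : monomialL2 m n ∈ hardy :=
  Submodule.le_topologicalClosure _ (Submodule.subset_span ⟨(m, n), rfl⟩)

theorem monomialL2_mem_hardyTwo (n : ℕ) : monomialL2 0 n ∈ hardyTwo :=
  Submodule.le_topologicalClosure _ (Submodule.subset_span ⟨n, rfl⟩)

theorem hardyTwo_le_hardy : hardyTwo ≤ hardy := by
  refine Submodule.topologicalClosure_mono (Submodule.span_mono ?_)
  rintro _ ⟨n, rfl⟩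
  exact ⟨(0, n), rfl⟩

theorem monomialL2_eq (m n : ℕ) :
    monomialL2 m n = ContinuousMap.toLp 2 volume ℂ (coordOne ^ m * coordTwo ^ n) := by
  rfl

/-- The geometric series of each Cauchy factor converges uniformly on the torus, hence in `L²`. -/
theorem szegoL2_mem_hardy {w : ℂ × ℂ} (hw : w ∈ bidisk) : szegoL2 w ∈ hardy := by
  have key : ∀ (x b : C(Torus, ℂ)), ‖x‖ < 1 →
      (∀ m : ℕ, ContinuousMap.toLp 2 volume ℂ (x ^ m * b) ∈ hardy) →
      ContinuousMap.toLp 2 volume ℂ (Ring.inverse (1 - x) * b) ∈ hardy := by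
    intro x b hx h
    have hs : HasSum (fun m : ℕ => x ^ m * b) (Ring.inverse (1 - x) * b) := by
      rw [← geom_series_eq_inverse x hx]
      exact (summable_geometric_of_norm_lt_one hx).hasSum.mul_right b
    have hs2 := hs.mapL (ContinuousMap.toLp 2 volume ℂ)
    exact isClosed_hardy.mem_of_tendsto hs2 (Eventually.of_forall fun s =>
      Submodule.sum_mem _ fun m _ => h m)
  have hw' := conj_mem_bidisk hw
  refine key _ _ (norm_smul_lt_one norm_coordOne_le hw'.1) fun m => ?_
  rw [mul_comm]
  refine key _ _ (norm_smul_lt_one norm_coordTwo_le hw'.2) fun n => ?_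
  rw [smul_pow, smul_pow, smul_mul_assoc, mul_smul_comm, map_smul, map_smul, mul_comm,
    ← monomialL2_eq]
  exact Submodule.smul_mem _ _ (Submodule.smul_mem _ _ (monomialL2_mem_hardy m n))

/-! ### Dilates of holomorphic functions -/

/-- A function orthogonal to all Szegő kernels is orthogonal to all dilates of holomorphic
functions. With `r = s * s`, one factor `s` dilates `g` and the other moves the evaluation point of
the Cauchy kernel inside, so the dilate is a continuous superposition of kernels and Fubini applies.
-/
theorem integral_mul_conj_dilate_eq_zero {h : L2Torus} (hh : ∀ w ∈ bidisk, hardyEval h w = 0)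
    {g : ℂ × ℂ → ℂ} (hg : DifferentiableOn ℂ g bidisk) {r : ℝ} (h0 : 0 < r) (h1 : r < 1) :
    ∫ θ : Torus, h θ * conj (g ((r : ℂ) • torusPt θ)) = 0 := by
  set s : ℝ := √r
  have hs0 : 0 ≤ s := Real.sqrt_nonneg r
  have hs1 : s < 1 := by
    rw [Real.sqrt_lt' one_pos]; simpa using h1
  have hss : (s : ℂ) * s = r := by rw [← Complex.ofReal_mul, Real.mul_self_sqrt h0.le]
  have hG : Continuous fun η : Torus => conj (g ((s : ℂ) • torusPt η)) :=
    Complex.continuous_conj.comp (hg.continuousOn.comp_continuous (continuous_smul_torusPt s)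
      (smul_torusPt_mem_bidisk hs0 hs1))
  have hker : Continuous fun p : Torus × Torus => szego (torusPt p.1) ((s : ℂ) • torusPt p.2) :=
    continuousOn_szego.comp_continuous
      (f := fun p : Torus × Torus => (torusPt p.1, (s : ℂ) • torusPt p.2))
      ((continuous_torusPt.comp continuous_fst).prodMk
      ((continuous_smul_torusPt s).comp continuous_snd)) fun p =>
      ⟨⟨(norm_torusPt_fst _).le, (norm_torusPt_snd _).le⟩, smul_torusPt_mem_bidisk hs0 hs1 _⟩
  have e1 : ∀ θ : Torus, conj (g ((r : ℂ) • torusPt θ)) =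
      ∫ η : Torus, conj (g ((s : ℂ) • torusPt η)) * szego (torusPt θ) ((s : ℂ) • torusPt η) := by
    intro θ
    have := integral_torus_cauchy hg hs0 hs1 (smul_torusPt_mem_bidisk hs0 hs1 θ)
    rw [smul_smul, hss] at this
    rw [← this, ← integral_conj]
    congr 1
    ext η
    rw [map_mul, conj_szego]
    simp [szego, mul_assoc, mul_comm]
  simp_rw [e1, ← integral_const_mul]
  rw [integral_integral_swap]
  · have : ∀ η : Torus, ∫ θ : Torus, h θ * (conj (g ((s : ℂ) • torusPt η)) *
        szego (torusPt θ) ((s : ℂ) • torusPt η)) = 0 := by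
      intro η
      have h2 := hh _ (smul_torusPt_mem_bidisk hs0 hs1 η)
      rw [hardyEval] at h2
      simp_rw [mul_left_comm (h _)]
      rw [integral_const_mul, h2, mul_zero]
    rw [integral_congr_ae (Eventually.of_forall this), integral_zero]
  · have hf : Integrable (fun θ : Torus => h θ) := (Lp.memLp h).integrable (by norm_num)
    have hc : Continuous fun p : Torus × Torus => conj (g ((s : ℂ) • torusPt p.2)) *
        szego (torusPt p.1) ((s : ℂ) • torusPt p.2) := (hG.comp continuous_snd).mul hker
    obtain ⟨C, hC⟩ := isCompact_univ.exists_bound_of_continuousOn hc.continuousOn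
    exact (hf.comp_fst volume).mul_bdd hc.aestronglyMeasurable
      (Eventually.of_forall fun p => hC p (mem_univ p))

/-- The dilate `ζ ↦ g (r ζ)` as an element of `L²` of the torus, for `0 ≤ r < 1`. -/
noncomputable def dilateL2 (g : ℂ × ℂ → ℂ) (hg : DifferentiableOn ℂ g bidisk) (r : ℝ)
    (h0 : 0 ≤ r) (h1 : r < 1) : L2Torus :=
  ContinuousMap.toLp 2 volume ℂ ⟨fun θ => g ((r : ℂ) • torusPt θ),
    hg.continuousOn.comp_continuous (continuous_smul_torusPt r) (smul_torusPt_mem_bidisk h0 h1)⟩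

theorem coeFn_dilateL2 {g : ℂ × ℂ → ℂ} (hg : DifferentiableOn ℂ g bidisk) {r : ℝ}
    (h0 : 0 ≤ r) (h1 : r < 1) :
    dilateL2 g hg r h0 h1 =ᵐ[volume] fun θ => g ((r : ℂ) • torusPt θ) :=
  ContinuousMap.coeFn_toLp volume _

theorem hardyEval_dilateL2 {g : ℂ × ℂ → ℂ} (hg : DifferentiableOn ℂ g bidisk) {r : ℝ}
    (h0 : 0 ≤ r) (h1 : r < 1) {z : ℂ × ℂ} (hz : z ∈ bidisk) :
    hardyEval (dilateL2 g hg r h0 h1) z = g ((r : ℂ) • z) := by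
  rw [← integral_torus_cauchy hg h0 h1 hz, hardyEval]
  refine integral_congr_ae ?_
  filter_upwards [coeFn_dilateL2 hg h0 h1] with θ h
  rw [h]

theorem inner_dilateL2_eq_zero {h : L2Torus} (hh : ∀ w ∈ bidisk, hardyEval h w = 0)
    {g : ℂ × ℂ → ℂ} (hg : DifferentiableOn ℂ g bidisk) {r : ℝ} (h0 : 0 < r) (h1 : r < 1) :
    ⟪dilateL2 g hg r h0.le h1, h⟫_ℂ = 0 := by
  rw [← integral_mul_conj_dilate_eq_zero hh hg h0 h1, L2.inner_def]
  refine integral_congr_ae ?_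
  filter_upwards [coeFn_dilateL2 hg h0.le h1] with θ h
  rw [h, RCLike.inner_apply]

theorem dilateL2_mem_hardy {g : ℂ × ℂ → ℂ} (hg : DifferentiableOn ℂ g bidisk) {r : ℝ}
    (h0 : 0 < r) (h1 : r < 1) : dilateL2 g hg r h0.le h1 ∈ hardy := by
  have : CompleteSpace hardy := isClosed_hardy.completeSpace_coe
  rw [← Submodule.orthogonal_orthogonal hardy, Submodule.mem_orthogonal']
  intro h hh
  refine inner_dilateL2_eq_zero (fun w hw => ?_) hg h0 h1
  rw [← inner_szegoL2 hw]
  exact hh _ (szegoL2_mem_hardy hw)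

theorem dilateL2_monomial (m n : ℕ) (hg : DifferentiableOn ℂ (fun z => z.1 ^ m * z.2 ^ n) bidisk)
    {r : ℝ} (h0 : 0 ≤ r) (h1 : r < 1) :
    dilateL2 (fun z => z.1 ^ m * z.2 ^ n) hg r h0 h1 = ((r : ℂ) ^ (m + n)) • monomialL2 m n := by
  rw [monomialL2, ← map_smul, dilateL2]
  congr 1
  ext θ
  simp
  ring

theorem hardyEval_monomialL2 (m n : ℕ) {z : ℂ × ℂ} (hz : z ∈ bidisk) :
    hardyEval (monomialL2 m n) z = z.1 ^ m * z.2 ^ n := by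
  have hg : DifferentiableOn ℂ (fun z : ℂ × ℂ => z.1 ^ m * z.2 ^ n) bidisk := by fun_prop
  have h := hardyEval_dilateL2 hg (r := 1 / 2) (by norm_num) (by norm_num) hz
  rw [dilateL2_monomial, hardyEval_smul] at h
  have h2 : (((1 / 2 : ℝ) : ℂ) ^ (m + n)) ≠ 0 := by simp
  refine mul_left_cancel₀ h2 (h.trans ?_)
  simp only [Prod.smul_fst, Prod.smul_snd, smul_eq_mul]
  ring

/-- A function in the Hardy space is determined by its values on the bidisk. -/
theorem eq_zero_of_hardyEval_eq_zero {f : L2Torus} (hf : f ∈ hardy)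
    (h : ∀ z ∈ bidisk, hardyEval f z = 0) : f = 0 := by
  have hle : hardy ≤ (Submodule.span ℂ {f})ᗮ := by
    refine Submodule.topologicalClosure_minimal _ ?_ (Submodule.isClosed_orthogonal _)
    rw [Submodule.span_le]
    rintro _ ⟨⟨m, n⟩, rfl⟩
    rw [SetLike.mem_coe, Submodule.mem_orthogonal_singleton_iff_inner_left]
    have hg : DifferentiableOn ℂ (fun z : ℂ × ℂ => z.1 ^ m * z.2 ^ n) bidisk := by fun_prop
    -- The dilate of a monomial is `r ^ (m + n)` times the monomial, so any single `r` in `(0, 1)`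
    -- suffices.
    have h1 := inner_dilateL2_eq_zero h hg (r := 1 / 2) (by norm_num) (by norm_num)
    rw [dilateL2_monomial, inner_smul_left] at h1
    refine (mul_eq_zero.mp h1).resolve_left ?_
    simp
  have := hle hf
  rwa [Submodule.mem_orthogonal_singleton_iff_inner_left, inner_self_eq_zero] at this

theorem eq_of_hardyEval_eq {f g : L2Torus} (hf : f ∈ hardy) (hg : g ∈ hardy)
    (h : ∀ z ∈ bidisk, hardyEval f z = hardyEval g z) : f = g := by
  refine sub_eq_zero.mp (eq_zero_of_hardyEval_eq_zero (sub_mem hf hg) fun z hz => ?_)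
  rw [← inner_szegoL2 hz, inner_sub_right, inner_szegoL2 hz, inner_szegoL2 hz, h z hz, sub_self]

/-! ### Multiplication operators -/

section mulLp

variable {μ : Measure Torus} {b c : Torus → ℂ}

theorem coeFn_mulLp (hb : MemLp b ∞ μ) (f : Lp ℂ 2 μ) :
    mulLp μ b f =ᵐ[μ] fun θ => b θ * f θ := by
  rw [mulLp, dif_pos hb]
  refine ((ContinuousLinearMap.mul ℂ ℂ).coeFn_holder (hb.toLp b) f).trans ?_
  filter_upwards [hb.coeFn_toLp] with θ h
  rw [h, ContinuousLinearMap.mul_apply']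

theorem inner_mulLp_left (hb : MemLp b ∞ μ) (hb' : MemLp (fun θ => conj (b θ)) ∞ μ)
    (f g : Lp ℂ 2 μ) : ⟪mulLp μ b f, g⟫_ℂ = ⟪f, mulLp μ (fun θ => conj (b θ)) g⟫_ℂ := by
  rw [L2.inner_def, L2.inner_def]
  refine integral_congr_ae ?_
  filter_upwards [coeFn_mulLp hb f, coeFn_mulLp hb' g] with θ h1 h2
  rw [h1, h2, RCLike.inner_apply, RCLike.inner_apply, map_mul]
  ring

theorem memLp_top_of_norm_eq_one (hm : AEStronglyMeasurable b μ) (h1 : ∀ᵐ θ ∂μ, ‖b θ‖ = 1) :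
    MemLp b ∞ μ :=
  memLp_top_of_bound hm 1 (h1.mono fun _ h => h.le)

theorem memLp_top_conj_of_norm_eq_one (hm : AEStronglyMeasurable b μ)
    (h1 : ∀ᵐ θ ∂μ, ‖b θ‖ = 1) : MemLp (fun θ => conj (b θ)) ∞ μ :=
  memLp_top_of_norm_eq_one (Complex.continuous_conj.comp_aestronglyMeasurable hm)
    (h1.mono fun _ h => by rw [RCLike.norm_conj, h])

theorem mulLp_conj_mulLp (hm : AEStronglyMeasurable b μ) (h1 : ∀ᵐ θ ∂μ, ‖b θ‖ = 1)
    (f : Lp ℂ 2 μ) : mulLp μ (fun θ => conj (b θ)) (mulLp μ b f) = f := by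
  refine Lp.ext ?_
  filter_upwards [coeFn_mulLp (memLp_top_conj_of_norm_eq_one hm h1) (mulLp μ b f),
    coeFn_mulLp (memLp_top_of_norm_eq_one hm h1) f, h1] with θ h2 h3 h4
  rw [h2, h3, ← mul_assoc, mul_comm (conj _), Complex.mul_conj, Complex.normSq_eq_norm_sq, h4]
  simp

theorem mulLp_mulLp_conj (hm : AEStronglyMeasurable b μ) (h1 : ∀ᵐ θ ∂μ, ‖b θ‖ = 1)
    (f : Lp ℂ 2 μ) : mulLp μ b (mulLp μ (fun θ => conj (b θ)) f) = f := by
  refine Lp.ext ?_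
  filter_upwards [coeFn_mulLp (memLp_top_of_norm_eq_one hm h1) (mulLp μ (fun θ => conj (b θ)) f),
    coeFn_mulLp (memLp_top_conj_of_norm_eq_one hm h1) f, h1] with θ h2 h3 h4
  rw [h2, h3, ← mul_assoc, Complex.mul_conj, Complex.normSq_eq_norm_sq, h4]
  simp

theorem adjoint_mulLp (hm : AEStronglyMeasurable b μ) (h1 : ∀ᵐ θ ∂μ, ‖b θ‖ = 1) :
    ContinuousLinearMap.adjoint (mulLp μ b) = mulLp μ (fun θ => conj (b θ)) := by
  refine ((ContinuousLinearMap.eq_adjoint_iff _ _).mpr fun f g => ?_).symm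
  rw [← inner_conj_symm, ← inner_mulLp_left (memLp_top_of_norm_eq_one hm h1)
    (memLp_top_conj_of_norm_eq_one hm h1), inner_conj_symm]

theorem mulLp_mem_unitary (hm : AEStronglyMeasurable b μ) (h1 : ∀ᵐ θ ∂μ, ‖b θ‖ = 1) :
    mulLp μ b ∈ unitary (Lp ℂ 2 μ →L[ℂ] Lp ℂ 2 μ) := by
  rw [Unitary.mem_iff, ContinuousLinearMap.star_eq_adjoint, adjoint_mulLp hm h1]
  exact ⟨ContinuousLinearMap.ext (mulLp_conj_mulLp hm h1),
    ContinuousLinearMap.ext (mulLp_mulLp_conj hm h1)⟩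

theorem inner_mulLp_mulLp (hm : AEStronglyMeasurable b μ) (h1 : ∀ᵐ θ ∂μ, ‖b θ‖ = 1)
    (f g : Lp ℂ 2 μ) : ⟪mulLp μ b f, mulLp μ b g⟫_ℂ = ⟪f, g⟫_ℂ := by
  rw [inner_mulLp_left (memLp_top_of_norm_eq_one hm h1) (memLp_top_conj_of_norm_eq_one hm h1),
    mulLp_conj_mulLp hm h1]

theorem aestronglyMeasurable_torusPt_fst : AEStronglyMeasurable (fun θ => (torusPt θ).1) μ :=
  continuous_torusPt.fst.aestronglyMeasurable

theorem ae_norm_torusPt_fst : ∀ᵐ θ ∂μ, ‖(torusPt θ).1‖ = 1 :=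
  Eventually.of_forall norm_torusPt_fst

theorem coeFn_mulZ1 (f : Lp ℂ 2 μ) : mulZ1 μ f =ᵐ[μ] fun θ => (torusPt θ).1 * f θ :=
  coeFn_mulLp (memLp_top_of_norm_eq_one aestronglyMeasurable_torusPt_fst ae_norm_torusPt_fst) f

theorem mulZ1_mem_unitary (μ : Measure Torus) : mulZ1 μ ∈ unitary (Lp ℂ 2 μ →L[ℂ] Lp ℂ 2 μ) :=
  mulLp_mem_unitary aestronglyMeasurable_torusPt_fst ae_norm_torusPt_fst

theorem inner_mulZ1_mulZ1 (f g : Lp ℂ 2 μ) : ⟪mulZ1 μ f, mulZ1 μ g⟫_ℂ = ⟪f, g⟫_ℂ :=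
  inner_mulLp_mulLp aestronglyMeasurable_torusPt_fst ae_norm_torusPt_fst f g

end mulLp

/-! ### Boundary values of bounded holomorphic functions -/

theorem tendsto_smul_nhdsLT_one (z : ℂ × ℂ) :
    Tendsto (fun r : ℝ => (r : ℂ) • z) (𝓝[<] 1) (𝓝 z) := by
  have h : Tendsto (fun r : ℝ => (r : ℂ) • z) (𝓝 1) (𝓝 (((1 : ℝ) : ℂ) • z)) :=
    Continuous.tendsto (by fun_prop) 1
  rw [Complex.ofReal_one, one_smul] at h
  exact h.mono_left nhdsWithin_le_nhds

theorem eventually_mem_Ioo_nhdsLT_one : ∀ᶠ r : ℝ in 𝓝[<] 1, r ∈ Ioo (0 : ℝ) 1 :=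
  Ioo_mem_nhdsLT one_pos

theorem tendsto_integral_mul_dilate {g : ℂ × ℂ → ℂ} (hg : DifferentiableOn ℂ g bidisk) {C : ℝ}
    (hC : ∀ z ∈ bidisk, ‖g z‖ ≤ C) {G : Torus → ℂ}
    (hG : ∀ᵐ θ : Torus, Tendsto (fun r : ℝ => g ((r : ℂ) • torusPt θ)) (𝓝[<] 1) (𝓝 (G θ)))
    {h : Torus → ℂ} (hh : Integrable h) :
    Tendsto (fun r : ℝ => ∫ θ : Torus, g ((r : ℂ) • torusPt θ) * h θ) (𝓝[<] 1)
      (𝓝 (∫ θ : Torus, G θ * h θ)) := by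
  refine tendsto_integral_filter_of_dominated_convergence (fun θ => C * ‖h θ‖) ?_ ?_
    (hh.norm.const_mul C) ?_
  · filter_upwards [eventually_mem_Ioo_nhdsLT_one] with r hr
    exact (hg.continuousOn.comp_continuous (continuous_smul_torusPt r)
      (smul_torusPt_mem_bidisk hr.1.le hr.2)).aestronglyMeasurable.mul hh.aestronglyMeasurable
  · filter_upwards [eventually_mem_Ioo_nhdsLT_one] with r hr
    refine Eventually.of_forall fun θ => ?_
    rw [norm_mul]
    exact mul_le_mul_of_nonneg_right (hC _ (smul_torusPt_mem_bidisk hr.1.le hr.2 θ))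
      (norm_nonneg _)
  · filter_upwards [hG] with θ hθ
    exact hθ.mul_const _

/-- Both claims hold for the dilates of `g` and pass to the limit `r → 1` by dominated convergence.
-/
theorem hardy_of_radial_limit {g : ℂ × ℂ → ℂ} (hg : DifferentiableOn ℂ g bidisk) {C : ℝ}
    (hC : ∀ z ∈ bidisk, ‖g z‖ ≤ C) {G : L2Torus}
    (hG : ∀ᵐ θ : Torus, Tendsto (fun r : ℝ => g ((r : ℂ) • torusPt θ)) (𝓝[<] 1) (𝓝 (G θ))) :
    G ∈ hardy ∧ ∀ z ∈ bidisk, hardyEval G z = g z := by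
  constructor
  · have : CompleteSpace hardy := isClosed_hardy.completeSpace_coe
    rw [← Submodule.orthogonal_orthogonal hardy, Submodule.mem_orthogonal]
    intro h hh
    have hi : Integrable (fun θ : Torus => conj (h θ)) := by
      have : Integrable (fun θ : Torus => h θ) := (Lp.memLp h).integrable (by norm_num)
      exact (Complex.conjCLE : ℂ →L[ℝ] ℂ).integrable_comp this
    have h1 := tendsto_integral_mul_dilate hg hC hG hi
    have h2 : ∀ᶠ r : ℝ in 𝓝[<] 1, ∫ θ : Torus, g ((r : ℂ) • torusPt θ) * conj (h θ) = 0 := by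
      filter_upwards [eventually_mem_Ioo_nhdsLT_one] with r hr
      have h3 := (Submodule.mem_orthogonal' _ _).mp hh _ (dilateL2_mem_hardy hg hr.1 hr.2)
      rw [L2.inner_def] at h3
      rw [← h3]
      refine integral_congr_ae ?_
      filter_upwards [coeFn_dilateL2 hg hr.1.le hr.2] with θ h
      rw [h, RCLike.inner_apply]
    rw [L2.inner_def]
    simp only [RCLike.inner_apply]
    exact tendsto_nhds_unique_of_eventuallyEq h1 tendsto_const_nhds h2
  · intro z hz
    have h1 := tendsto_integral_mul_dilate hg hC hG
      (integrable_of_continuous_torus (continuous_szego_torusPt hz))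
    have h2 : Tendsto (fun r : ℝ => g ((r : ℂ) • z)) (𝓝[<] 1) (𝓝 (g z)) :=
      ((hg.continuousOn.continuousAt (isOpen_bidisk.mem_nhds hz)).tendsto).comp
        (tendsto_smul_nhdsLT_one z)
    refine tendsto_nhds_unique_of_eventuallyEq h1 h2 ?_
    filter_upwards [eventually_mem_Ioo_nhdsLT_one] with r hr
    exact integral_torus_cauchy hg hr.1.le hr.2 hz

theorem hardy_le_of_monomialL2_mem {S : Submodule ℂ L2Torus} (hS : IsClosed (S : Set L2Torus))
    (h : ∀ m n, monomialL2 m n ∈ S) : hardy ≤ S := by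
  refine Submodule.topologicalClosure_minimal _ ?_ hS
  rw [Submodule.span_le]
  rintro _ ⟨⟨m, n⟩, rfl⟩
  exact h m n

theorem hardyTwo_le_of_monomialL2_mem {S : Submodule ℂ L2Torus} (hS : IsClosed (S : Set L2Torus))
    (h : ∀ n, monomialL2 0 n ∈ S) : hardyTwo ≤ S := by
  refine Submodule.topologicalClosure_minimal _ ?_ hS
  rw [Submodule.span_le]
  rintro _ ⟨n, rfl⟩
  exact h n

theorem coeFn_monomialL2 (m n : ℕ) :
    monomialL2 m n =ᵐ[volume] fun θ => (torusPt θ).1 ^ m * (torusPt θ).2 ^ n :=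
  ContinuousMap.coeFn_toLp volume _

/-- Multiplication by the boundary function of a bounded holomorphic function preserves the Hardy
space and is pointwise multiplication on the bidisk. -/
theorem mulLp_mem_hardy_and_hardyEval {g : ℂ × ℂ → ℂ} (hg : DifferentiableOn ℂ g bidisk) {C : ℝ}
    (hC : ∀ z ∈ bidisk, ‖g z‖ ≤ C) {b : Torus → ℂ} (hb : MemLp b ∞ volume)
    (hG : ∀ᵐ θ : Torus, Tendsto (fun r : ℝ => g ((r : ℂ) • torusPt θ)) (𝓝[<] 1) (𝓝 (b θ)))
    {f : L2Torus} (hf : f ∈ hardy) :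
    mulLp volume b f ∈ hardy ∧
      ∀ z ∈ bidisk, hardyEval (mulLp volume b f) z = g z * hardyEval f z := by
  have hmon : ∀ m n, mulLp volume b (monomialL2 m n) ∈ hardy ∧ ∀ z ∈ bidisk,
      hardyEval (mulLp volume b (monomialL2 m n)) z = g z * (z.1 ^ m * z.2 ^ n) := by
    intro m n
    refine hardy_of_radial_limit (g := fun z => g z * (z.1 ^ m * z.2 ^ n)) (C := C)
      (hg.mul (by fun_prop)) (fun z hz => ?_) ?_
    · rw [norm_mul, norm_mul, norm_pow, norm_pow]
      have h1 := pow_le_one₀ (n := m) (norm_nonneg z.1) hz.1.le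
      have h2 := pow_le_one₀ (n := n) (norm_nonneg z.2) hz.2.le
      exact (mul_le_of_le_one_right (norm_nonneg _) (mul_le_one₀ h1 (by positivity) h2)).trans
        (hC z hz)
    · filter_upwards [hG, coeFn_mulLp hb (monomialL2 m n), coeFn_monomialL2 m n] with θ h1 h2 h3
      rw [h2, h3]
      have h4 : Continuous fun z : ℂ × ℂ => z.1 ^ m * z.2 ^ n := by fun_prop
      exact h1.mul ((h4.tendsto _).comp (tendsto_smul_nhdsLT_one (torusPt θ)))
  constructor
  · have hS : IsClosed ((hardy.comap (mulLp volume b).toLinearMap : Submodule ℂ L2Torus) :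
        Set L2Torus) := isClosed_hardy.preimage (mulLp volume b).continuous
    exact hardy_le_of_monomialL2_mem hS (fun m n => (hmon m n).1) hf
  · intro z hz
    -- The defect of the product formula is a continuous functional of `f`, so its vanishing on
    -- monomials suffices.
    set T : L2Torus →L[ℂ] ℂ :=
      innerSL ℂ (szegoL2 z) ∘L mulLp volume b - g z • innerSL ℂ (szegoL2 z)
    have hT : ∀ f, T f = hardyEval (mulLp volume b f) z - g z * hardyEval f z := by
      intro f
      simp [T, inner_szegoL2 hz]
    have h := hardy_le_of_monomialL2_mem (S := LinearMap.ker T.toLinearMap) T.isClosed_ker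
      (fun m n => by
        change T _ = 0
        rw [hT, (hmon m n).2 z hz, hardyEval_monomialL2 m n hz, sub_self]) hf
    have h' : T f = 0 := h
    rw [hT] at h'
    exact sub_eq_zero.mp h'

theorem norm_prod_eq_one {ζ : ℂ × ℂ} (h1 : ‖ζ.1‖ = 1) (h2 : ‖ζ.2‖ = 1) : ‖ζ‖ = 1 := by
  rw [Prod.norm_def, h1, h2, max_self]

theorem HasNontangentialLimit.tendsto_radial {g : ℂ × ℂ → ℂ} {θ : Torus} {c : ℂ}
    (h : HasNontangentialLimit g (torusPt θ) c) :
    Tendsto (fun r : ℝ => g ((r : ℂ) • torusPt θ)) (𝓝[<] 1) (𝓝 c) := by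
  -- In the maximum norm both `‖ζ - rζ‖` and `1 - ‖rζ‖` equal `1 - r`, so any aperture above `1`
  -- contains the radius.
  refine (h 2).comp (tendsto_nhdsWithin_iff.mpr ⟨tendsto_smul_nhdsLT_one _, ?_⟩)
  filter_upwards [eventually_mem_Ioo_nhdsLT_one] with r hr
  refine ⟨smul_torusPt_mem_bidisk hr.1.le hr.2 θ, ?_⟩
  have hn : ‖torusPt θ‖ = 1 := norm_prod_eq_one (norm_torusPt_fst θ) (norm_torusPt_snd θ)
  have h1 : torusPt θ - (r : ℂ) • torusPt θ = ((1 - r : ℝ) : ℂ) • torusPt θ := by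
    push_cast
    rw [sub_smul, one_smul]
  rw [h1, norm_smul, norm_smul, hn, Complex.norm_real, Complex.norm_real,
    Real.norm_of_nonneg hr.1.le, Real.norm_of_nonneg (by linarith [hr.2])]
  linarith [hr.2]

theorem radialLimit_eq {g : ℂ × ℂ → ℂ} {θ : Torus} {c : ℂ}
    (h : Tendsto (fun r : ℝ => g ((r : ℂ) • torusPt θ)) (𝓝[<] 1) (𝓝 c)) :
    radialLimit g θ = c := h.limUnder_eq

theorem aestronglyMeasurable_of_radial {g : ℂ × ℂ → ℂ} (hg : DifferentiableOn ℂ g bidisk)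
    {b : Torus → ℂ}
    (hG : ∀ᵐ θ : Torus, Tendsto (fun r : ℝ => g ((r : ℂ) • torusPt θ)) (𝓝[<] 1) (𝓝 (b θ))) :
    AEStronglyMeasurable b volume := by
  have h := aestronglyMeasurable_of_tendsto_ae (μ := (volume : Measure Torus)) (𝓝[<] (1 : ℝ))
    -- Outside `(0, 1)` nothing is known about `g (r ζ)`; the cutoff makes every member of the
    -- family measurable.
    (f := fun (r : ℝ) (θ : Torus) => if r ∈ Ioo (0 : ℝ) 1 then g ((r : ℂ) • torusPt θ) else 0)
    (g := b) (fun r => ?_) ?_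
  · exact h
  · by_cases hr : r ∈ Ioo (0 : ℝ) 1
    · simp only [hr, if_true]
      exact (hg.continuousOn.comp_continuous (continuous_smul_torusPt r)
        (smul_torusPt_mem_bidisk hr.1.le hr.2)).aestronglyMeasurable
    · simp only [hr, if_false]
      exact aestronglyMeasurable_const
  · filter_upwards [hG] with θ hθ
    refine hθ.congr' ?_
    filter_upwards [eventually_mem_Ioo_nhdsLT_one] with r hr
    simp [hr]

namespace IsInner

variable {φ : ℂ × ℂ → ℂ}

theorem ae_tendsto_radial (hφ : IsInner φ) : ∀ᵐ θ : Torus,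
    Tendsto (fun r : ℝ => φ ((r : ℂ) • torusPt θ)) (𝓝[<] 1) (𝓝 (radialLimit φ θ)) := by
  filter_upwards [hφ.unimodular] with θ ⟨c, _, h⟩
  rw [radialLimit_eq h.tendsto_radial]
  exact h.tendsto_radial

theorem ae_norm_radialLimit (hφ : IsInner φ) : ∀ᵐ θ : Torus, ‖radialLimit φ θ‖ = 1 := by
  filter_upwards [hφ.unimodular] with θ ⟨c, hc, h⟩
  rw [radialLimit_eq h.tendsto_radial, hc]

theorem aestronglyMeasurable_radialLimit (hφ : IsInner φ) :
    AEStronglyMeasurable (radialLimit φ) (volume : Measure Torus) :=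
  aestronglyMeasurable_of_radial hφ.differentiableOn hφ.ae_tendsto_radial

theorem memLp_radialLimit (hφ : IsInner φ) : MemLp (radialLimit φ) ∞ (volume : Measure Torus) :=
  memLp_top_of_norm_eq_one hφ.aestronglyMeasurable_radialLimit hφ.ae_norm_radialLimit

end IsInner

/-- Multiplication on `L²` of the torus by the boundary function of `φ`. -/
noncomputable def innerMul (φ : ℂ × ℂ → ℂ) : L2Torus →L[ℂ] L2Torus :=
  mulLp volume (radialLimit φ)

namespace IsInner

variable {φ : ℂ × ℂ → ℂ}

theorem innerMul_mem_hardy (hφ : IsInner φ) {f : L2Torus} (hf : f ∈ hardy) :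
    innerMul φ f ∈ hardy := by
  obtain ⟨C, hC⟩ := hφ.bounded
  exact (mulLp_mem_hardy_and_hardyEval hφ.differentiableOn hC hφ.memLp_radialLimit
    hφ.ae_tendsto_radial hf).1

theorem hardyEval_innerMul (hφ : IsInner φ) {f : L2Torus} (hf : f ∈ hardy) {z : ℂ × ℂ}
    (hz : z ∈ bidisk) : hardyEval (innerMul φ f) z = φ z * hardyEval f z := by
  obtain ⟨C, hC⟩ := hφ.bounded
  exact (mulLp_mem_hardy_and_hardyEval hφ.differentiableOn hC hφ.memLp_radialLimit
    hφ.ae_tendsto_radial hf).2 z hz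

theorem inner_innerMul (hφ : IsInner φ) (f g : L2Torus) :
    ⟪innerMul φ f, innerMul φ g⟫_ℂ = ⟪f, g⟫_ℂ :=
  inner_mulLp_mulLp hφ.aestronglyMeasurable_radialLimit hφ.ae_norm_radialLimit f g

theorem norm_innerMul (hφ : IsInner φ) (f : L2Torus) : ‖innerMul φ f‖ = ‖f‖ := by
  rw [norm_eq_sqrt_re_inner (𝕜 := ℂ), hφ.inner_innerMul, ← norm_eq_sqrt_re_inner]

/-- `φ M` is the image of `M` under multiplication by the boundary function of `φ`. -/
theorem mulSubspace_eq_map (hφ : IsInner φ) {M : Submodule ℂ L2Torus} (hM : M ≤ hardy) :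
    mulSubspace φ M = M.map (innerMul φ).toLinearMap := by
  ext g
  constructor
  · rintro ⟨hg, f, hf, h⟩
    refine ⟨f, hf, (eq_of_hardyEval_eq hg (hφ.innerMul_mem_hardy (hM hf)) fun z hz => ?_).symm⟩
    rw [h z hz, hφ.hardyEval_innerMul (hM hf) hz]
  · rintro ⟨f, hf, rfl⟩
    exact ⟨hφ.innerMul_mem_hardy (hM hf), f, hf, fun z hz => hφ.hardyEval_innerMul (hM hf) hz⟩

/-- The reproducing property gives `⟪k_z, φ k_z⟫ = φ(z) ‖k_z‖²`; multiplication by `φ` is isometric,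
so Cauchy–Schwarz bounds `|φ(z)|`. The kernel is nonzero because it pairs to `1` with the constant
`1`. -/
theorem norm_le_one (hφ : IsInner φ) {z : ℂ × ℂ} (hz : z ∈ bidisk) : ‖φ z‖ ≤ 1 := by
  have h1 : ⟪szegoL2 z, innerMul φ (szegoL2 z)⟫_ℂ = φ z * ⟪szegoL2 z, szegoL2 z⟫_ℂ := by
    rw [inner_szegoL2 hz, inner_szegoL2 hz, hφ.hardyEval_innerMul (szegoL2_mem_hardy hz) hz]
  have h2 : ⟪szegoL2 z, innerMul φ (szegoL2 z)⟫_ℂ = φ z * (‖szegoL2 z‖ : ℂ) ^ 2 := by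
    rw [h1, inner_self_eq_norm_sq_to_K]; rfl
  have h3 := norm_inner_le_norm (𝕜 := ℂ) (szegoL2 z) (innerMul φ (szegoL2 z))
  rw [h2, hφ.norm_innerMul, norm_mul, norm_pow, Complex.norm_real, norm_norm] at h3
  have h4 : 0 < ‖szegoL2 z‖ := by
    rw [norm_pos_iff]
    intro h0
    have h5 := inner_szegoL2 hz (monomialL2 0 0)
    rw [h0, inner_zero_left, hardyEval_monomialL2 0 0 hz] at h5
    simp at h5
  nlinarith [mul_pos h4 h4]

end IsInner

/-! ### The shift in the first variable -/

theorem mulZ1_mem_hardy {f : L2Torus} (hf : f ∈ hardy) : mulZ1 volume f ∈ hardy :=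
  (mulLp_mem_hardy_and_hardyEval (g := Prod.fst) (C := 1) (by fun_prop) (fun _ hz => hz.1.le)
    (memLp_top_of_norm_eq_one aestronglyMeasurable_torusPt_fst ae_norm_torusPt_fst)
    (Eventually.of_forall fun θ => (continuous_fst.tendsto _).comp
      (tendsto_smul_nhdsLT_one (torusPt θ))) hf).1

theorem hardyEval_mulZ1 {f : L2Torus} (hf : f ∈ hardy) {z : ℂ × ℂ} (hz : z ∈ bidisk) :
    hardyEval (mulZ1 volume f) z = z.1 * hardyEval f z :=
  (mulLp_mem_hardy_and_hardyEval (g := Prod.fst) (C := 1) (by fun_prop) (fun _ hz => hz.1.le)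
    (memLp_top_of_norm_eq_one aestronglyMeasurable_torusPt_fst ae_norm_torusPt_fst)
    (Eventually.of_forall fun θ => (continuous_fst.tendsto _).comp
      (tendsto_smul_nhdsLT_one (torusPt θ))) hf).2 z hz

theorem mulZ1_monomialL2 (m n : ℕ) :
    mulZ1 volume (monomialL2 m n) = monomialL2 (m + 1) n := by
  refine Lp.ext ?_
  filter_upwards [coeFn_mulZ1 (monomialL2 m n), coeFn_monomialL2 m n, coeFn_monomialL2 (m + 1) n]
    with θ h1 h2 h3
  rw [h1, h2, h3]
  ring

theorem inner_monomialL2_mulZ1_monomialL2 (k m n : ℕ) :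
    ⟪monomialL2 0 k, mulZ1 volume (monomialL2 m n)⟫_ℂ = 0 := by
  have h0 : ∫ θ : UnitAddCircle, (AddCircle.toCircle θ : ℂ) ^ (m + 1) = 0 := by
    have := integral_circle_cauchy (g := fun s => s ^ (m + 1)) (z := 0)
      (Differentiable.diffContOnCl (by fun_prop)) (by simp)
    simpa using this
  rw [mulZ1_monomialL2, L2.inner_def]
  calc _ = ∫ θ : Torus, (AddCircle.toCircle θ.1 : ℂ) ^ (m + 1) *
        ((AddCircle.toCircle θ.2 : ℂ) ^ n * conj ((AddCircle.toCircle θ.2 : ℂ) ^ k)) := by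
        refine integral_congr_ae ?_
        filter_upwards [coeFn_monomialL2 0 k, coeFn_monomialL2 (m + 1) n] with θ h1 h2
        rw [h1, h2, RCLike.inner_apply, torusPt]
        simp only [pow_zero, one_mul]
        ring
    _ = 0 := by
        rw [Measure.volume_eq_prod, integral_prod_mul
          (fun x : UnitAddCircle => (AddCircle.toCircle x : ℂ) ^ (m + 1))
          (fun y : UnitAddCircle => (AddCircle.toCircle y : ℂ) ^ n *
            conj ((AddCircle.toCircle y : ℂ) ^ k)), h0, zero_mul]

theorem inner_hardyTwo_mulZ1 {f g : L2Torus} (hf : f ∈ hardyTwo) (hg : g ∈ hardy) :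
    ⟪f, mulZ1 volume g⟫_ℂ = 0 := by
  have h1 : ∀ k, ⟪monomialL2 0 k, mulZ1 volume g⟫_ℂ = 0 := fun k =>
    hardy_le_of_monomialL2_mem
      (S := LinearMap.ker (innerSL ℂ (monomialL2 0 k) ∘L mulZ1 volume).toLinearMap)
      (innerSL ℂ (monomialL2 0 k) ∘L mulZ1 volume).isClosed_ker
      (fun m n => inner_monomialL2_mulZ1_monomialL2 k m n) hg
  have h2 : hardyTwo ≤ (Submodule.span ℂ {mulZ1 volume g})ᗮ :=
    hardyTwo_le_of_monomialL2_mem (Submodule.isClosed_orthogonal _) fun k =>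
      Submodule.mem_orthogonal_singleton_iff_inner_left.mpr (h1 k)
  exact Submodule.mem_orthogonal_singleton_iff_inner_left.mp (h2 hf)

theorem mulZ1_mem_hardyTwo_orthogonal {g : L2Torus} (hg : g ∈ hardy) :
    mulZ1 volume g ∈ hardyTwoᗮ := fun _ hf => inner_hardyTwo_mulZ1 hf hg

/-- The backward shift in the first variable on `L²` of the torus. -/
noncomputable def backwardShiftL2 : L2Torus →L[ℂ] L2Torus :=
  ContinuousLinearMap.adjoint (mulZ1 volume) ∘L
    (ContinuousLinearMap.id ℂ L2Torus - hardyTwo.starProjection)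

theorem adjoint_mulZ1_mulZ1 (μ : Measure Torus) (f : Lp ℂ 2 μ) :
    ContinuousLinearMap.adjoint (mulZ1 μ) (mulZ1 μ f) = f :=
  congrArg (fun T : Lp ℂ 2 μ →L[ℂ] Lp ℂ 2 μ => T f)
    (Unitary.mem_iff.mp (mulZ1_mem_unitary μ)).1

theorem mulZ1_adjoint_mulZ1 (μ : Measure Torus) (f : Lp ℂ 2 μ) :
    mulZ1 μ (ContinuousLinearMap.adjoint (mulZ1 μ) f) = f :=
  congrArg (fun T : Lp ℂ 2 μ →L[ℂ] Lp ℂ 2 μ => T f)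
    (Unitary.mem_iff.mp (mulZ1_mem_unitary μ)).2

theorem starProjection_hardyTwo_add_mulZ1 (f : L2Torus) :
    hardyTwo.starProjection f + mulZ1 volume (backwardShiftL2 f) = f := by
  simp [backwardShiftL2, mulZ1_adjoint_mulZ1]

/-- On monomials the operator lowers the exponent of `ζ₁` by one, or gives zero. With
`starProjection_hardyTwo_add_mulZ1` this is the splitting `H² = H²₂ ⊕ z₁H²`. -/
theorem backwardShiftL2_mem_hardy {f : L2Torus} (hf : f ∈ hardy) : backwardShiftL2 f ∈ hardy := by
  refine hardy_le_of_monomialL2_mem (S := hardy.comap backwardShiftL2.toLinearMap)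
    (isClosed_hardy.preimage backwardShiftL2.continuous) (fun m n => ?_) hf
  change backwardShiftL2 (monomialL2 m n) ∈ hardy
  cases m with
  | zero =>
    have : hardyTwo.starProjection (monomialL2 0 n) = monomialL2 0 n :=
      Submodule.starProjection_eq_self_iff.mpr (monomialL2_mem_hardyTwo n)
    simp [backwardShiftL2, this]
  | succ m =>
    have : hardyTwo.starProjection (monomialL2 (m + 1) n) = 0 := by
      rw [← mulZ1_monomialL2]
      exact (Submodule.starProjection_apply_eq_zero_iff _).mpr
        (mulZ1_mem_hardyTwo_orthogonal (monomialL2_mem_hardy m n))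
    have h2 : backwardShiftL2 (monomialL2 (m + 1) n) = monomialL2 m n := by
      simp only [backwardShiftL2, ContinuousLinearMap.comp_apply, _root_.sub_apply,
        ContinuousLinearMap.id_apply, this, sub_zero]
      rw [← mulZ1_monomialL2, adjoint_mulZ1_mulZ1]
    rw [h2]
    exact monomialL2_mem_hardy m n

theorem hardyEval_hardyTwo {f : L2Torus} (hf : f ∈ hardyTwo) {z : ℂ × ℂ} (hz : z ∈ bidisk) :
    hardyEval f z = hardyEval f (0, z.2) := by
  have hz' : ((0 : ℂ), z.2) ∈ bidisk := ⟨by simp, hz.2⟩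
  set T : L2Torus →L[ℂ] ℂ := innerSL ℂ (szegoL2 z) - innerSL ℂ (szegoL2 (0, z.2))
  have hT : ∀ f, T f = hardyEval f z - hardyEval f (0, z.2) := fun f => by
    simp [T, inner_szegoL2 hz, inner_szegoL2 hz']
  have h : T f = 0 := hardyTwo_le_of_monomialL2_mem (S := LinearMap.ker T.toLinearMap)
    T.isClosed_ker (fun n => by
      change T _ = 0
      rw [hT, hardyEval_monomialL2 0 n hz, hardyEval_monomialL2 0 n hz']
      simp) hf
  rw [hT] at h
  exact sub_eq_zero.mp h

/-! ### Division by the first coordinate -/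

/-- The boundary function splits as an `H²₂` part plus `z₁` times its backward shift. Setting `z₁ =
0` shows that the first part, which does not depend on `z₁`, vanishes. -/
theorem IsInner.eq_mul_hardyEval {φ : ℂ × ℂ → ℂ} (hφ : IsInner φ)
    (hzero : ∀ z₂ : ℂ, ‖z₂‖ < 1 → φ (0, z₂) = 0) :
    ∃ h ∈ hardy, ∀ z ∈ bidisk, φ z = z.1 * hardyEval h z := by
  set G := innerMul φ (monomialL2 0 0)
  have hG : G ∈ hardy := hφ.innerMul_mem_hardy (monomialL2_mem_hardy 0 0)
  have hGe : ∀ z ∈ bidisk, hardyEval G z = φ z := fun z hz => by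
    rw [hφ.hardyEval_innerMul (monomialL2_mem_hardy 0 0) hz, hardyEval_monomialL2 0 0 hz]
    simp
  have hA := backwardShiftL2_mem_hardy hG
  refine ⟨backwardShiftL2 G, hA, fun z hz => ?_⟩
  have hsum : ∀ z ∈ bidisk, φ z =
      hardyEval (hardyTwo.starProjection G) z + z.1 * hardyEval (backwardShiftL2 G) z := by
    intro z hz
    rw [← hGe z hz, ← hardyEval_mulZ1 hA hz, ← hardyEval_add _ _ hz,
      starProjection_hardyTwo_add_mulZ1]
  have hz' : ((0 : ℂ), z.2) ∈ bidisk := ⟨by simp, hz.2⟩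
  have h0 := hsum _ hz'
  rw [hzero _ hz.2, zero_mul, add_zero] at h0
  rw [hsum z hz, hardyEval_hardyTwo (Submodule.starProjection_apply_mem _ _) hz, ← h0, zero_add]

theorem backwardShift_eq {φ ψ : ℂ × ℂ → ℂ} (hψ : DifferentiableOn ℂ ψ bidisk)
    (h : ∀ z ∈ bidisk, φ z = z.1 * ψ z) {z : ℂ × ℂ} (hz : z ∈ bidisk) :
    backwardShift φ z = ψ z := by
  have hslice : ∀ s : ℂ, ‖s‖ < 1 → φ (s, z.2) = s * ψ (s, z.2) := fun s hs => h _ ⟨hs, hz.2⟩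
  have h0 : φ (0, z.2) = 0 := by rw [hslice 0 (by simp), zero_mul]
  rw [backwardShift]
  by_cases hz1 : z.1 = 0
  · have hd : DifferentiableAt ℂ (fun s => ψ (s, z.2)) 0 := by
      have : DifferentiableAt ℂ ψ ((fun s : ℂ => (s, z.2)) 0) :=
        hψ.differentiableAt (isOpen_bidisk.mem_nhds ⟨by simp, hz.2⟩)
      exact this.comp (0 : ℂ) (f := fun s : ℂ => (s, z.2)) (by fun_prop)
    have hder : HasDerivAt (fun s => φ (s, z.2)) (1 * ψ (0, z.2) + 0 * deriv (fun s => ψ (s, z.2)) 0)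
        0 := by
      refine ((hasDerivAt_id (0 : ℂ)).mul hd.hasDerivAt).congr_of_eventuallyEq ?_
      filter_upwards [Metric.ball_mem_nhds (0 : ℂ) one_pos] with s hs
      exact hslice s (by simpa using hs)
    rw [hz1, dslope_same, hder.deriv, one_mul, zero_mul, add_zero]
    congr 1
    ext <;> simp [hz1]
  · rw [dslope_of_ne _ hz1, slope_def_field, h0, hslice _ hz.1]
    simp
    field_simp

theorem oneAlpha_eq {φ ψ : ℂ × ℂ → ℂ} (hψ : DifferentiableOn ℂ ψ bidisk)
    (h : ∀ z ∈ bidisk, φ z = z.1 * ψ z) (α : ℂ) {z : ℂ × ℂ} (hz : z ∈ bidisk) :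
    oneAlpha φ α z = conj α * ψ z := by
  have hz' : ((0 : ℂ), z.2) ∈ bidisk := ⟨by simp, hz.2⟩
  rw [oneAlpha, backwardShift_eq hψ h hz, h _ hz']
  simp

theorem IsInner.exists_eq_mul {φ : ℂ × ℂ → ℂ} (hφ : IsInner φ) {α : ℂ} (hα : ‖α‖ = 1)
    (hbdd : ∃ C : ℝ, ∀ z ∈ bidisk, ‖oneAlpha φ α z‖ ≤ C)
    (hzero : ∀ z₂ : ℂ, ‖z₂‖ < 1 → φ (0, z₂) = 0) :
    ∃ ψ : ℂ × ℂ → ℂ, IsInner ψ ∧ ∀ z ∈ bidisk, φ z = z.1 * ψ z := by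
  obtain ⟨h, -, hmul⟩ := hφ.eq_mul_hardyEval hzero
  refine ⟨hardyEval h, ⟨differentiableOn_hardyEval h, ?_, ?_⟩, hmul⟩
  · obtain ⟨C, hC⟩ := hbdd
    refine ⟨C, fun z hz => ?_⟩
    have := hC z hz
    rwa [oneAlpha_eq (differentiableOn_hardyEval h) hmul α hz, norm_mul, RCLike.norm_conj, hα,
      one_mul] at this
  · filter_upwards [hφ.unimodular] with θ ⟨c, hc, hlim⟩
    have hne : (torusPt θ).1 ≠ 0 := fun h0 => by
      have := norm_torusPt_fst θ
      simp [h0] at this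
    refine ⟨c / (torusPt θ).1, by rw [norm_div, hc, norm_torusPt_fst, div_one], fun κ => ?_⟩
    have h1 : Tendsto (fun z : ℂ × ℂ => z.1) (𝓝[approachRegion κ (torusPt θ)] torusPt θ)
        (𝓝 (torusPt θ).1) := (continuous_fst.tendsto _).mono_left nhdsWithin_le_nhds
    refine ((hlim κ).div h1 hne).congr' ?_
    filter_upwards [h1.eventually_ne hne, self_mem_nhdsWithin] with z hz hz'
    rw [Pi.div_apply, hmul z hz'.1, mul_div_cancel_left₀ _ hz]

/-! ### Model spaces -/

theorem mem_modelSpace_iff {φ : ℂ × ℂ → ℂ} (hφ : IsInner φ) {f : L2Torus} :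
    f ∈ modelSpace φ ↔ f ∈ hardy ∧ ∀ g ∈ hardy, ⟪innerMul φ g, f⟫_ℂ = 0 := by
  rw [modelSpace, Submodule.mem_inf, Submodule.mem_orthogonal, hφ.mulSubspace_eq_map le_rfl]
  refine and_congr_right fun _ => ⟨fun h g hg => h _ ⟨g, hg, rfl⟩, ?_⟩
  rintro h _ ⟨g, hg, rfl⟩
  exact h g hg

/-- As multiplication by `ψ` is isometric, the component of `f` in `ψH²` is `ψ P_{H²}(conj ψ f)`. -/
theorem exists_modelSpace_add_innerMul {ψ : ℂ × ℂ → ℂ} (hψ : IsInner ψ) {f : L2Torus}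
    (hf : f ∈ hardy) : ∃ f₁ ∈ modelSpace ψ, ∃ g ∈ hardy, f = f₁ + innerMul ψ g := by
  have : CompleteSpace hardy := isClosed_hardy.completeSpace_coe
  set u := ContinuousLinearMap.adjoint (innerMul ψ) f
  have hg : hardy.starProjection u ∈ hardy := Submodule.starProjection_apply_mem _ _
  refine ⟨f - innerMul ψ (hardy.starProjection u), ?_, hardy.starProjection u, hg, by abel⟩
  refine (mem_modelSpace_iff hψ).mpr ⟨sub_mem hf (hψ.innerMul_mem_hardy hg), fun g hg' => ?_⟩
  rw [inner_sub_right, hψ.inner_innerMul, ← ContinuousLinearMap.adjoint_inner_right,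
    ← inner_sub_right]
  exact Submodule.sub_starProjection_mem_orthogonal u g hg'

theorem mem_hardy_of_mem_modelSpace {φ : ℂ × ℂ → ℂ} {f : L2Torus} (hf : f ∈ modelSpace φ) :
    f ∈ hardy := (Submodule.mem_inf.mp hf).1

section decomposition

variable {φ ψ : ℂ × ℂ → ℂ}

theorem innerMul_eq_innerMul_mulZ1 (hφ : IsInner φ) (hψ : IsInner ψ)
    (hmul : ∀ z ∈ bidisk, φ z = z.1 * ψ z) {g : L2Torus} (hg : g ∈ hardy) :
    innerMul φ g = innerMul ψ (mulZ1 volume g) := by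
  refine eq_of_hardyEval_eq (hφ.innerMul_mem_hardy hg)
    (hψ.innerMul_mem_hardy (mulZ1_mem_hardy hg)) fun z hz => ?_
  rw [hφ.hardyEval_innerMul hg hz, hψ.hardyEval_innerMul (mulZ1_mem_hardy hg) hz,
    hardyEval_mulZ1 hg hz, hmul z hz]
  ring

theorem innerMul_eq_mulZ1_innerMul (hφ : IsInner φ) (hψ : IsInner ψ)
    (hmul : ∀ z ∈ bidisk, φ z = z.1 * ψ z) {g : L2Torus} (hg : g ∈ hardy) :
    innerMul φ g = mulZ1 volume (innerMul ψ g) := by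
  refine eq_of_hardyEval_eq (hφ.innerMul_mem_hardy hg)
    (mulZ1_mem_hardy (hψ.innerMul_mem_hardy hg)) fun z hz => ?_
  rw [hφ.hardyEval_innerMul hg hz, hardyEval_mulZ1 (hψ.innerMul_mem_hardy hg) hz,
    hψ.hardyEval_innerMul hg hz, hmul z hz]
  ring

theorem modelSpace_le_modelSpace (hφ : IsInner φ) (hψ : IsInner ψ)
    (hmul : ∀ z ∈ bidisk, φ z = z.1 * ψ z) : modelSpace ψ ≤ modelSpace φ := by
  intro f hf
  rw [mem_modelSpace_iff hψ] at hf
  refine (mem_modelSpace_iff hφ).mpr ⟨hf.1, fun g hg => ?_⟩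
  rw [innerMul_eq_innerMul_mulZ1 hφ hψ hmul hg]
  exact hf.2 _ (mulZ1_mem_hardy hg)

theorem innerMul_mem_modelSpace (hφ : IsInner φ) (hψ : IsInner ψ)
    (hmul : ∀ z ∈ bidisk, φ z = z.1 * ψ z) {f : L2Torus} (hf : f ∈ hardyTwo) :
    innerMul ψ f ∈ modelSpace φ := by
  refine (mem_modelSpace_iff hφ).mpr
    ⟨hψ.innerMul_mem_hardy (hardyTwo_le_hardy hf), fun g hg => ?_⟩
  rw [innerMul_eq_innerMul_mulZ1 hφ hψ hmul hg, hψ.inner_innerMul, ← inner_conj_symm,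
    inner_hardyTwo_mulZ1 hf hg, map_zero]

theorem hardyTwo_le_modelSpace (hφ : IsInner φ) (hψ : IsInner ψ)
    (hmul : ∀ z ∈ bidisk, φ z = z.1 * ψ z) : hardyTwo ≤ modelSpace φ := by
  intro f hf
  refine (mem_modelSpace_iff hφ).mpr ⟨hardyTwo_le_hardy hf, fun g hg => ?_⟩
  rw [innerMul_eq_mulZ1_innerMul hφ hψ hmul hg, ← inner_conj_symm,
    inner_hardyTwo_mulZ1 hf (hψ.innerMul_mem_hardy hg), map_zero]

theorem mulZ1_mem_modelSpace (hφ : IsInner φ) (hψ : IsInner ψ)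
    (hmul : ∀ z ∈ bidisk, φ z = z.1 * ψ z) {f : L2Torus} (hf : f ∈ modelSpace ψ) :
    mulZ1 volume f ∈ modelSpace φ := by
  rw [mem_modelSpace_iff hψ] at hf
  refine (mem_modelSpace_iff hφ).mpr ⟨mulZ1_mem_hardy hf.1, fun g hg => ?_⟩
  rw [innerMul_eq_mulZ1_innerMul hφ hψ hmul hg, inner_mulZ1_mulZ1]
  exact hf.2 g hg

theorem isOrtho_modelSpace_mulSubspace (hψ : IsInner ψ) :
    modelSpace ψ ⟂ mulSubspace ψ hardyTwo := by
  rw [Submodule.isOrtho_iff_inner_eq, hψ.mulSubspace_eq_map hardyTwo_le_hardy]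
  rintro f hf _ ⟨g, hg, rfl⟩
  rw [← inner_conj_symm]
  exact (map_eq_zero _).mpr (((mem_modelSpace_iff hψ).mp hf).2 g (hardyTwo_le_hardy hg))

theorem exists_modelSpace_add_hardyTwo (hφ : IsInner φ) (hψ : IsInner ψ)
    (hmul : ∀ z ∈ bidisk, φ z = z.1 * ψ z) {f : L2Torus} (hf : f ∈ modelSpace φ) :
    ∃ f₁ ∈ modelSpace ψ, ∃ f₂ ∈ hardyTwo, f = f₁ + innerMul ψ f₂ := by
  obtain ⟨f₁, hf₁, g, hg, rfl⟩ := exists_modelSpace_add_innerMul hψ (mem_hardy_of_mem_modelSpace hf)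
  have hP : hardyTwo.starProjection g ∈ hardyTwo := Submodule.starProjection_apply_mem _ _
  have hA := backwardShiftL2_mem_hardy hg
  have hsplit : innerMul ψ g = innerMul ψ (hardyTwo.starProjection g) +
      innerMul φ (backwardShiftL2 g) := by
    rw [innerMul_eq_innerMul_mulZ1 hφ hψ hmul hA, ← map_add, starProjection_hardyTwo_add_mulZ1]
  refine ⟨f₁, hf₁, _, hP, ?_⟩
  -- The total, `f₁` and `ψ P g` all lie in `K_φ`; hence the remaining term, which lies in `φH²`, is
  -- orthogonal to itself.
  have h1 := ((mem_modelSpace_iff hφ).mp (modelSpace_le_modelSpace hφ hψ hmul hf₁)).2 _ hA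
  have h2 := ((mem_modelSpace_iff hφ).mp (innerMul_mem_modelSpace hφ hψ hmul hP)).2 _ hA
  have h3 := ((mem_modelSpace_iff hφ).mp hf).2 _ hA
  rw [hsplit, inner_add_right, inner_add_right, h1, h2, zero_add, zero_add,
    inner_self_eq_zero] at h3
  rw [hsplit, h3, add_zero]

theorem modelSpace_sup_mulSubspace (hφ : IsInner φ) (hψ : IsInner ψ)
    (hmul : ∀ z ∈ bidisk, φ z = z.1 * ψ z) :
    modelSpace ψ ⊔ mulSubspace ψ hardyTwo = modelSpace φ := by
  rw [hψ.mulSubspace_eq_map hardyTwo_le_hardy]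
  refine le_antisymm (sup_le (modelSpace_le_modelSpace hφ hψ hmul) ?_) fun f hf => ?_
  · rintro _ ⟨g, hg, rfl⟩
    exact innerMul_mem_modelSpace hφ hψ hmul hg
  · obtain ⟨f₁, hf₁, f₂, hf₂, rfl⟩ := exists_modelSpace_add_hardyTwo hφ hψ hmul hf
    exact Submodule.add_mem_sup hf₁ ⟨f₂, hf₂, rfl⟩

theorem eq_add_innerMul_iff (hψ : IsInner ψ) {f f₁ f₂ : L2Torus} (hf : f ∈ hardy)
    (hf₁ : f₁ ∈ hardy) (hf₂ : f₂ ∈ hardy) :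
    f = f₁ + innerMul ψ f₂ ↔
      ∀ z ∈ bidisk, hardyEval f z = hardyEval f₁ z + ψ z * hardyEval f₂ z := by
  have h : ∀ z ∈ bidisk, hardyEval (f₁ + innerMul ψ f₂) z =
      hardyEval f₁ z + ψ z * hardyEval f₂ z := fun z hz => by
    rw [hardyEval_add _ _ hz, hψ.hardyEval_innerMul hf₂ hz]
  constructor
  · rintro rfl
    exact h
  · intro h'
    exact eq_of_hardyEval_eq hf (add_mem hf₁ (hψ.innerMul_mem_hardy hf₂)) fun z hz => by
      rw [h' z hz, h z hz]

theorem existsUnique_modelSpace_hardyTwo (hφ : IsInner φ) (hψ : IsInner ψ)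
    (hmul : ∀ z ∈ bidisk, φ z = z.1 * ψ z) (f : modelSpace φ) :
    ∃! p : modelSpace ψ × hardyTwo, ∀ z ∈ bidisk,
      hardyEval f z = hardyEval p.1 z + ψ z * hardyEval p.2 z := by
  obtain ⟨f₁, hf₁, f₂, hf₂, hf⟩ := exists_modelSpace_add_hardyTwo hφ hψ hmul f.2
  have hiff : ∀ p : modelSpace ψ × hardyTwo, (∀ z ∈ bidisk,
      hardyEval f z = hardyEval p.1 z + ψ z * hardyEval p.2 z) ↔
      (f : L2Torus) = p.1 + innerMul ψ p.2 := fun p =>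
    (eq_add_innerMul_iff hψ (mem_hardy_of_mem_modelSpace f.2)
      (mem_hardy_of_mem_modelSpace p.1.2) (hardyTwo_le_hardy p.2.2)).symm
  simp_rw [hiff]
  refine ⟨(⟨f₁, hf₁⟩, ⟨f₂, hf₂⟩), hf, ?_⟩
  rintro ⟨⟨g₁, hg₁⟩, ⟨g₂, hg₂⟩⟩ hg
  change (f : L2Torus) = g₁ + innerMul ψ g₂ at hg
  have h1 : g₁ - f₁ = innerMul ψ (f₂ - g₂) := by
    rw [map_sub, sub_eq_sub_iff_add_eq_add, ← hg, hf, add_comm]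
  -- The difference lies both in `K_ψ` and in `ψH²₂`, hence is orthogonal to itself; only the left
  -- slot of the inner product is to be rewritten.
  have h2 : g₁ - f₁ = 0 := by
    rw [← inner_self_eq_zero (𝕜 := ℂ)]
    conv_lhs => rw [h1]
    rw [← h1]
    nth_rewrite 1 [h1]
    exact ((mem_modelSpace_iff hψ).mp (sub_mem hg₁ hf₁)).2 _
      (hardyTwo_le_hardy (sub_mem hf₂ hg₂))
  have h3 : f₂ - g₂ = 0 := by
    rw [← norm_eq_zero, ← hψ.norm_innerMul, ← h1, h2, norm_zero]
  rw [sub_eq_zero] at h2 h3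
  simp [h2, h3]

/-! ### The Clark unitary -/

theorem coeFn_adjoint_innerMul (hψ : IsInner ψ) (f : L2Torus) :
    ContinuousLinearMap.adjoint (innerMul ψ) f =ᵐ[volume]
      fun θ => conj (radialLimit ψ θ) * f θ := by
  rw [innerMul, adjoint_mulLp hψ.aestronglyMeasurable_radialLimit hψ.ae_norm_radialLimit]
  exact coeFn_mulLp (memLp_top_conj_of_norm_eq_one hψ.aestronglyMeasurable_radialLimit
    hψ.ae_norm_radialLimit) f

/-- On the bidisk `𝟏_α = conj α * ψ`, so its conjugate has boundary function `α conj ψ`. -/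
theorem mulLp_radialLimit_oneAlpha (hψ : IsInner ψ) (hmul : ∀ z ∈ bidisk, φ z = z.1 * ψ z)
    {α : ℂ} (hα : ‖α‖ = 1) (f : L2Torus) :
    mulLp volume (radialLimit fun z => conj (oneAlpha φ α z)) f =
      α • ContinuousLinearMap.adjoint (innerMul ψ) f := by
  have h1 : (radialLimit fun z => conj (oneAlpha φ α z)) =ᵐ[volume]
      fun θ => α * conj (radialLimit ψ θ) := by
    filter_upwards [hψ.ae_tendsto_radial] with θ hθ
    refine radialLimit_eq ?_
    refine ((Complex.continuous_conj.tendsto _).comp hθ |>.const_mul α).congr' ?_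
    filter_upwards [eventually_mem_Ioo_nhdsLT_one] with r hr
    rw [oneAlpha_eq hψ.differentiableOn hmul α (smul_torusPt_mem_bidisk hr.1.le hr.2 θ)]
    simp
  have h2 : AEStronglyMeasurable (fun θ => α * conj (radialLimit ψ θ))
      (volume : Measure Torus) :=
    (Complex.continuous_conj.comp_aestronglyMeasurable
      hψ.aestronglyMeasurable_radialLimit).const_mul α
  have h3 : MemLp (radialLimit fun z => conj (oneAlpha φ α z)) ∞ (volume : Measure Torus) := by
    refine memLp_top_of_norm_eq_one (h2.congr h1.symm) ?_
    filter_upwards [h1, hψ.ae_norm_radialLimit] with θ h4 h5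
    rw [h4, norm_mul, RCLike.norm_conj, hα, h5, one_mul]
  refine Lp.ext ?_
  filter_upwards [h1, coeFn_mulLp h3 f, coeFn_adjoint_innerMul hψ f,
    Lp.coeFn_smul α (ContinuousLinearMap.adjoint (innerMul ψ) f)] with θ h4 h5 h6 h7
  rw [h5, h4, h7, Pi.smul_apply, h6, smul_eq_mul, mul_assoc]

/-- Pairing with `g ∈ H²₂` gives `⟪ψg, f₁⟫ + ⟪g, f₂⟫`, and the first term vanishes. -/
theorem starProjection_hardyTwo_adjoint_innerMul (hψ : IsInner ψ) {f₁ f₂ : L2Torus}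
    (hf₁ : f₁ ∈ modelSpace ψ) (hf₂ : f₂ ∈ hardyTwo) :
    hardyTwo.starProjection (ContinuousLinearMap.adjoint (innerMul ψ) (f₁ + innerMul ψ f₂)) =
      f₂ := by
  refine Submodule.eq_starProjection_of_mem_orthogonal hf₂ fun g hg => ?_
  rw [inner_sub_right, ContinuousLinearMap.adjoint_inner_right, inner_add_right,
    hψ.inner_innerMul, ((mem_modelSpace_iff hψ).mp hf₁).2 g (hardyTwo_le_hardy hg)]
  simp

/-- `z₁(f₁ + ψf₂) = z₁f₁ + φf₂`, with the first term in `K_φ` and the second orthogonal to it. -/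
theorem coe_compressedShift_add (hφ : IsInner φ) (hψ : IsInner ψ)
    (hmul : ∀ z ∈ bidisk, φ z = z.1 * ψ z) (f : modelSpace φ) {f₁ f₂ : L2Torus}
    (hf₁ : f₁ ∈ modelSpace ψ) (hf₂ : f₂ ∈ hardyTwo) (hf : (f : L2Torus) = f₁ + innerMul ψ f₂) :
    (compressedShift φ f : L2Torus) = mulZ1 volume f₁ := by
  change (modelSpace φ).starProjection (mulZ1 volume (f : L2Torus)) = _
  rw [hf, map_add, ← innerMul_eq_mulZ1_innerMul hφ hψ hmul (hardyTwo_le_hardy hf₂)]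
  refine Submodule.eq_starProjection_of_mem_orthogonal (mulZ1_mem_modelSpace hφ hψ hmul hf₁) ?_
  rw [add_sub_cancel_left, Submodule.mem_orthogonal']
  exact fun g hg => ((mem_modelSpace_iff hφ).mp hg).2 f₂ (hardyTwo_le_hardy hf₂)

theorem coe_clarkUnitary_sub (hφ : IsInner φ) (hψ : IsInner ψ)
    (hmul : ∀ z ∈ bidisk, φ z = z.1 * ψ z) {α : ℂ} (hα : ‖α‖ = 1) (f : modelSpace φ)
    {f₁ f₂ : L2Torus} (hf₁ : f₁ ∈ modelSpace ψ) (hf₂ : f₂ ∈ hardyTwo)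
    (hf : (f : L2Torus) = f₁ + innerMul ψ f₂) :
    ((clarkUnitary φ α - compressedShift φ) f : L2Torus) = α • f₂ := by
  rw [clarkUnitary, add_sub_cancel_left]
  change (modelSpace φ).starProjection (hardyTwo.starProjection
    (mulLp volume (radialLimit fun z => conj (oneAlpha φ α z)) (f : L2Torus))) = _
  rw [mulLp_radialLimit_oneAlpha hψ hmul hα, map_smul, hf,
    starProjection_hardyTwo_adjoint_innerMul hψ hf₁ hf₂]
  exact Submodule.starProjection_eq_self_iff.mpr
    (Submodule.smul_mem _ _ (hardyTwo_le_modelSpace hφ hψ hmul hf₂))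

theorem coe_clarkUnitary (hφ : IsInner φ) (hψ : IsInner ψ)
    (hmul : ∀ z ∈ bidisk, φ z = z.1 * ψ z) {α : ℂ} (hα : ‖α‖ = 1) (f : modelSpace φ)
    {f₁ f₂ : L2Torus} (hf₁ : f₁ ∈ modelSpace ψ) (hf₂ : f₂ ∈ hardyTwo)
    (hf : (f : L2Torus) = f₁ + innerMul ψ f₂) :
    (clarkUnitary φ α f : L2Torus) = mulZ1 volume f₁ + α • f₂ := by
  rw [← coe_compressedShift_add hφ hψ hmul f hf₁ hf₂ hf,
    ← coe_clarkUnitary_sub hφ hψ hmul hα f hf₁ hf₂ hf, ← Submodule.coe_add]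
  simp

theorem hardyEval_clarkUnitary (hφ : IsInner φ) (hψ : IsInner ψ)
    (hmul : ∀ z ∈ bidisk, φ z = z.1 * ψ z) {α : ℂ} (hα : ‖α‖ = 1) (f : modelSpace φ)
    (f₁ : modelSpace ψ) (f₂ : hardyTwo)
    (hf : ∀ z ∈ bidisk, hardyEval f z = hardyEval f₁ z + ψ z * hardyEval f₂ z)
    {z : ℂ × ℂ} (hz : z ∈ bidisk) :
    hardyEval (clarkUnitary φ α f) z = z.1 * hardyEval f₁ z + α * hardyEval f₂ z := by
  have hf₁ := mem_hardy_of_mem_modelSpace f₁.2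
  rw [coe_clarkUnitary hφ hψ hmul hα f f₁.2 f₂.2 ((eq_add_innerMul_iff hψ
    (mem_hardy_of_mem_modelSpace f.2) hf₁ (hardyTwo_le_hardy f₂.2)).mpr hf),
    hardyEval_add _ _ hz, hardyEval_mulZ1 hf₁ hz, hardyEval_smul]

/-! ### Infinite rank -/

/-- Polynomials in `ζ₂` embed in `R`: the Cauchy integral recovers their values on a disk, which
determine them. -/
theorem not_finiteDimensional_of_monomialL2_mem {R : Submodule ℂ L2Torus}
    (hR : ∀ n, monomialL2 0 n ∈ R) : ¬ FiniteDimensional ℂ R := by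
  intro hfin
  set T : Polynomial ℂ →ₗ[ℂ] L2Torus :=
    (ContinuousMap.toLp 2 volume ℂ).toLinearMap ∘ₗ (Polynomial.aeval coordTwo).toLinearMap
  have hT : ∀ n : ℕ, T (Polynomial.X ^ n) = monomialL2 0 n := by
    intro n
    rw [monomialL2_eq]
    simp [T]
  have hind : ∀ {S : Submodule ℂ (Polynomial ℂ)}, (∀ n : ℕ, Polynomial.X ^ n ∈ S) → ∀ p, p ∈ S := by
    intro S hS p
    induction p using Polynomial.induction_on' with
    | add p q hp hq => exact add_mem hp hq
    | monomial n a =>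
      rw [← Polynomial.C_mul_X_pow_eq_monomial, ← Polynomial.smul_eq_C_mul]
      exact Submodule.smul_mem _ _ (hS n)
  have hmem : ∀ p, T p ∈ R := hind (S := R.comap T) fun n => by
    rw [Submodule.mem_comap, hT]
    exact hR n
  have heval : ∀ (w : ℂ), ‖w‖ < 1 → ∀ p : Polynomial ℂ, hardyEval (T p) (0, w) = p.eval w := by
    intro w hw p
    have hz : ((0 : ℂ), w) ∈ bidisk := ⟨by simp, hw⟩
    have := hind (S := LinearMap.ker ((innerSL ℂ (szegoL2 (0, w))).toLinearMap ∘ₗ T -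
      Polynomial.leval w)) (fun n => by
        rw [LinearMap.mem_ker, LinearMap.sub_apply, LinearMap.comp_apply, hT]
        simp [inner_szegoL2 hz, hardyEval_monomialL2 0 n hz]) p
    rw [LinearMap.mem_ker, LinearMap.sub_apply, sub_eq_zero] at this
    rw [← inner_szegoL2 hz]
    exact this
  have hinj : Function.Injective (T.codRestrict R hmem) := by
    rw [← LinearMap.ker_eq_bot, LinearMap.ker_eq_bot']
    intro p hp
    have hp' : T p = 0 := congrArg Subtype.val hp
    refine Polynomial.eq_zero_of_infinite_isRoot p ?_
    refine (infinite_of_mem_nhds (0 : ℂ) (Metric.ball_mem_nhds 0 one_pos)).mono fun w hw => ?_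
    have h := heval w (by simpa using hw) p
    have hz : ((0 : ℂ), w) ∈ bidisk := ⟨by simp, by simpa using hw⟩
    rw [hp', ← inner_szegoL2 hz, inner_zero_right] at h
    exact h.symm
  exact Polynomial.not_finite (R := ℂ) (Module.Finite.of_injective _ hinj)

theorem not_finiteDimensional_range_clarkUnitary_sub (hφ : IsInner φ) (hψ : IsInner ψ)
    (hmul : ∀ z ∈ bidisk, φ z = z.1 * ψ z) {α : ℂ} (hα : ‖α‖ = 1) :
    ¬ FiniteDimensional ℂ
      (LinearMap.range (clarkUnitary φ α - compressedShift φ).toLinearMap) := by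
  intro hfin
  have hα0 : α ≠ 0 := fun h => by simp [h] at hα
  refine not_finiteDimensional_of_monomialL2_mem
    (R := (LinearMap.range (clarkUnitary φ α - compressedShift φ).toLinearMap).map
      (modelSpace φ).subtype) (fun n => ?_) inferInstance
  have hn : α⁻¹ • monomialL2 0 n ∈ hardyTwo :=
    Submodule.smul_mem _ _ (monomialL2_mem_hardyTwo n)
  set f : modelSpace φ := ⟨innerMul ψ (α⁻¹ • monomialL2 0 n),
    innerMul_mem_modelSpace hφ hψ hmul hn⟩
  refine ⟨(clarkUnitary φ α - compressedShift φ) f, ⟨f, rfl⟩, ?_⟩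
  have := coe_clarkUnitary_sub hφ hψ hmul hα f (zero_mem _) hn (by simp [f])
  rw [smul_smul, mul_inv_cancel₀ hα0, one_smul] at this
  exact this

end decomposition

/-! ### Polarization of identities between holomorphic functions -/

theorem eqOn_zero_of_real_eq_zero {f : ℂ → ℂ} {ρ : ℝ} (hρ : 0 < ρ)
    (hf : DifferentiableOn ℂ f (Metric.ball 0 ρ)) (h : ∀ x : ℝ, |x| < ρ → f x = 0) :
    ∀ z : ℂ, ‖z‖ < ρ → f z = 0 := by
  intro z hz
  refine (hf.analyticOnNhd Metric.isOpen_ball).eqOn_zero_of_preconnected_of_frequently_eq_zero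
    (convex_ball _ _).isPreconnected (Metric.mem_ball_self hρ) ?_ (by simpa using hz)
  have ht : Tendsto (fun x : ℝ => (x : ℂ)) (𝓝[≠] 0) (𝓝[≠] 0) := by
    refine tendsto_nhdsWithin_iff.mpr ⟨?_, ?_⟩
    · exact (Complex.continuous_ofReal.tendsto' 0 0 (by simp)).mono_left nhdsWithin_le_nhds
    · filter_upwards [self_mem_nhdsWithin] with x hx
      simpa using hx
  refine ht.frequently (Eventually.frequently ?_)
  filter_upwards [nhdsWithin_le_nhds (Metric.ball_mem_nhds (0 : ℝ) hρ)] with x hx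
  exact h x (by simpa using hx)

/-- In coordinates `(x - iy, x + iy)` the hypothesis concerns real `x` and `y`; the identity theorem
frees first `x`, then `y`. Radius `1 / 4` keeps these points in the bidisk, and a further
continuation in each variable reaches all of it. -/
theorem eq_zero_of_eq_zero_on_antidiagonal {F : ℂ × ℂ → ℂ} (hF : DifferentiableOn ℂ F bidisk)
    (h : ∀ z : ℂ, ‖z‖ < 1 → F (conj z, z) = 0) {p : ℂ × ℂ} (hp : p ∈ bidisk) : F p = 0 := by
  have hnorm : ∀ {x y : ℂ}, ‖x‖ < 1 / 4 → ‖y‖ < 1 / 4 →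
      (x - Complex.I * y, x + Complex.I * y) ∈ bidisk := by
    intro x y hx hy
    have hI : ‖Complex.I * y‖ = ‖y‖ := by simp
    constructor
    · exact (norm_sub_le _ _).trans_lt (by rw [hI]; linarith)
    · exact (norm_add_le _ _).trans_lt (by rw [hI]; linarith)
  have h1 : ∀ y : ℝ, |y| < 1 / 4 → ∀ x : ℂ, ‖x‖ < 1 / 4 →
      F (x - Complex.I * y, x + Complex.I * y) = 0 := by
    intro y hy
    refine eqOn_zero_of_real_eq_zero (by norm_num) ?_ fun x hx => ?_
    · refine DifferentiableOn.comp hF (f := fun x : ℂ => (x - Complex.I * y, x + Complex.I * y))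
        (by fun_prop) fun x hx => hnorm (by simpa using hx) (by simpa using hy)
    · have h2 := h (x + Complex.I * y)
        (hnorm (x := (x : ℂ)) (y := (y : ℂ)) (by simpa using hx) (by simpa using hy)).2
      rw [← h2]
      congr 2
      simp [sub_eq_add_neg]
  have h2 : ∀ x : ℂ, ‖x‖ < 1 / 4 → ∀ y : ℂ, ‖y‖ < 1 / 4 →
      F (x - Complex.I * y, x + Complex.I * y) = 0 := by
    intro x hx
    refine eqOn_zero_of_real_eq_zero (by norm_num) ?_ fun y hy => h1 y hy x hx
    exact DifferentiableOn.comp hF (f := fun y : ℂ => (x - Complex.I * y, x + Complex.I * y))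
      (by fun_prop) fun y hy => hnorm hx (by simpa using hy)
  have h3 : ∀ u : ℂ, ‖u‖ < 1 / 4 → ∀ v : ℂ, ‖v‖ < 1 / 4 → F (u, v) = 0 := by
    intro u hu v hv
    have hx : ‖(u + v) / 2‖ < 1 / 4 := by
      have := norm_add_le u v
      rw [norm_div]
      norm_num
      linarith
    have hy : ‖Complex.I * (u - v) / 2‖ < 1 / 4 := by
      have := norm_sub_le u v
      rw [norm_div, norm_mul, Complex.norm_I]
      norm_num
      linarith
    have := h2 _ hx _ hy
    convert this using 2
    have hI := Complex.I_mul_I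
    ext1
    · linear_combination ((u - v) / 2) * hI
    · linear_combination (-(u - v) / 2) * hI
  have key : ∀ f : ℂ → ℂ, DifferentiableOn ℂ f (Metric.ball 0 1) →
      (∀ z : ℂ, ‖z‖ < 1 / 4 → f z = 0) → ∀ z : ℂ, ‖z‖ < 1 → f z = 0 := by
    intro f hf hz z hz1
    refine (hf.analyticOnNhd Metric.isOpen_ball).eqOn_zero_of_preconnected_of_eventuallyEq_zero
      (convex_ball _ _).isPreconnected (Metric.mem_ball_self one_pos) ?_ (by simpa using hz1)
    filter_upwards [Metric.ball_mem_nhds (0 : ℂ) (by norm_num : (0 : ℝ) < 1 / 4)] with w hw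
    exact hz w (by simpa using hw)
  have h4 : ∀ u : ℂ, ‖u‖ < 1 / 4 → ∀ v : ℂ, ‖v‖ < 1 → F (u, v) = 0 := by
    intro u hu
    refine key _ (DifferentiableOn.comp hF (f := fun v : ℂ => (u, v)) (by fun_prop)
      fun v hv => ⟨by simpa using hu.trans (by norm_num), by simpa using hv⟩) (h3 u hu)
  exact key (fun u => F (u, p.2)) (DifferentiableOn.comp hF (f := fun u : ℂ => (u, p.2))
    (by fun_prop) fun u hu => ⟨by simpa using hu, hp.2⟩) (fun u hu => h4 u hu p.2 hp.2) p.1 hp.1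

/-- The one-variable polarization is applied to the pair of first coordinates, then to the pair of
second ones. -/
theorem eq_zero_of_eq_zero_on_antidiagonal_bidisk {F : (ℂ × ℂ) × (ℂ × ℂ) → ℂ}
    (hF : DifferentiableOn ℂ F (bidisk ×ˢ bidisk))
    (h : ∀ w ∈ bidisk, F ((conj w.1, conj w.2), w) = 0) {u v : ℂ × ℂ} (hu : u ∈ bidisk)
    (hv : v ∈ bidisk) : F (u, v) = 0 := by
  have h1 : ∀ w₂ : ℂ, ‖w₂‖ < 1 → ∀ p ∈ bidisk, F ((p.1, conj w₂), (p.2, w₂)) = 0 := by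
    intro w₂ hw p hp
    refine eq_zero_of_eq_zero_on_antidiagonal (F := fun p => F ((p.1, conj w₂), (p.2, w₂)))
      (DifferentiableOn.comp hF (f := fun p : ℂ × ℂ => ((p.1, conj w₂), (p.2, w₂))) (by fun_prop)
        fun q hq => ⟨⟨hq.1, by simpa using hw⟩, ⟨hq.2, hw⟩⟩) (fun z hz => h (z, w₂) ⟨hz, hw⟩) hp
  exact eq_zero_of_eq_zero_on_antidiagonal (F := fun p => F ((u.1, p.1), (v.1, p.2)))
      (p := (u.2, v.2))
      (DifferentiableOn.comp hF (f := fun p : ℂ × ℂ => ((u.1, p.1), (v.1, p.2))) (by fun_prop)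
        fun q hq => ⟨⟨hu.1, hq.1⟩, ⟨hv.1, hq.2⟩⟩)
      (fun z hz => h1 z hz (u.1, v.1) ⟨hu.1, hv.1⟩) ⟨hu.2, hv.2⟩

/-! ### The Clark measure -/

theorem norm_sub_eq_norm_one_sub_mul_conj (z : ℂ) {ζ : ℂ} (hζ : ‖ζ‖ = 1) :
    ‖ζ - z‖ = ‖1 - z * conj ζ‖ := by
  have h1 : ζ * conj ζ = 1 := by
    rw [Complex.mul_conj, Complex.normSq_eq_norm_sq, hζ]; simp
  have h2 : 1 - z * conj ζ = (ζ - z) * conj ζ := by rw [sub_mul, h1]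
  rw [h2, norm_mul, RCLike.norm_conj, hζ, mul_one]

theorem poissonDisk_mul_poissonDisk (w : ℂ × ℂ) (θ : Torus) :
    ((poissonDisk w.1 (torusPt θ).1 * poissonDisk w.2 (torusPt θ).2 : ℝ) : ℂ) =
      ((1 - ‖w.1‖ ^ 2) * (1 - ‖w.2‖ ^ 2) : ℝ) *
        (szego w (torusPt θ) * szego (torusPt θ) w) := by
  rw [← conj_szego (torusPt θ) w, mul_comm (conj _), Complex.mul_conj, Complex.normSq_eq_norm_sq,
    ← Complex.ofReal_mul]
  congr 1
  rw [szego, norm_div, norm_mul, poissonDisk, poissonDisk,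
    norm_sub_eq_norm_one_sub_mul_conj _ (norm_torusPt_fst θ),
    norm_sub_eq_norm_one_sub_mul_conj _ (norm_torusPt_snd θ), norm_one]
  rw [div_mul_div_comm, div_pow, one_pow, mul_one_div, mul_pow]

theorem differentiableOn_integral_cauchyMap_mul {σ : Measure Torus} [IsFiniteMeasure σ] :
    DifferentiableOn ℂ (fun p : (ℂ × ℂ) × (ℂ × ℂ) =>
      ∫ θ, cauchyMap coordOne coordTwo p.1 θ *
        cauchyMap (star coordOne) (star coordTwo) p.2 θ ∂σ) (bidisk ×ˢ bidisk) := by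
  have h1 : DifferentiableOn ℂ (fun p : (ℂ × ℂ) × (ℂ × ℂ) => cauchyMap coordOne coordTwo p.1)
      (bidisk ×ˢ bidisk) :=
    (differentiableOn_cauchyMap norm_coordOne_le norm_coordTwo_le).comp
      (f := fun p : (ℂ × ℂ) × (ℂ × ℂ) => p.1) differentiableOn_fst fun p hp => hp.1
  have h2 : DifferentiableOn ℂ (fun p : (ℂ × ℂ) × (ℂ × ℂ) =>
      cauchyMap (star coordOne) (star coordTwo) p.2) (bidisk ×ˢ bidisk) :=
    (differentiableOn_cauchyMap norm_star_coordOne_le norm_star_coordTwo_le).comp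
      (f := fun p : (ℂ × ℂ) × (ℂ × ℂ) => p.2) differentiableOn_snd fun p hp => hp.2
  refine (ContinuousMap.differentiableOn_integral_comp (μ := σ) (h1.mul h2)
    (Lp.const 2 σ (1 : ℂ))).congr fun p _ => ?_
  refine integral_congr_ae ?_
  filter_upwards [Lp.coeFn_const (p := 2) (μ := σ) (1 : ℂ)] with θ h
  rw [h]
  simp

/-- For `v = w` this is the Poisson identity, since the Poisson kernel is a multiple of `|k_w|²` and
`|1 - conj α φ| = |α - φ|`. Both sides are holomorphic in `(conj w, v)`, so the diagonal determines
them. -/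
theorem IsClarkMeasure.integral_szego_mul_szego {φ : ℂ × ℂ → ℂ}
    (hφ : DifferentiableOn ℂ φ bidisk) (hφ1 : ∀ z ∈ bidisk, ‖φ z‖ < 1) {α : ℂ} (hα : ‖α‖ = 1)
    {σ : Measure Torus} (hσ : IsClarkMeasure φ α σ) {w v : ℂ × ℂ} (hw : w ∈ bidisk)
    (hv : v ∈ bidisk) :
    (1 - α * conj (φ w)) * (1 - conj α * φ v) *
      ∫ θ, szego w (torusPt θ) * szego (torusPt θ) v ∂σ =
      (1 - φ v * conj (φ w)) * szego w v := by
  have := hσ.finite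
  have hα2 : α * conj α = 1 := by
    rw [Complex.mul_conj, Complex.normSq_eq_norm_sq, hα]; simp
  set F : (ℂ × ℂ) × (ℂ × ℂ) → ℂ := fun p =>
    (1 - α * conj (φ (star p.1))) * (1 - conj α * φ p.2) *
      (∫ θ, cauchyMap coordOne coordTwo p.1 θ *
        cauchyMap (star coordOne) (star coordTwo) p.2 θ ∂σ) -
      (1 - φ p.2 * conj (φ (star p.1))) *
        (1 / ((1 - p.2.1 * p.1.1) * (1 - p.2.2 * p.1.2))) with hFdef
  have hstar : ∀ u : ℂ × ℂ, u ∈ bidisk → star u ∈ bidisk := fun u hu => conj_mem_bidisk hu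
  have hd1 : DifferentiableOn ℂ (fun p : (ℂ × ℂ) × (ℂ × ℂ) => conj (φ (star p.1)))
      (bidisk ×ˢ bidisk) := by
    -- `star` is coordinatewise conjugation, and conjugating both argument and value preserves
    -- holomorphy.
    have h1 : DifferentiableOn ℂ (star ∘ φ ∘ star) bidisk := fun u hu => by
      have h2 := (hφ.differentiableAt (isOpen_bidisk.mem_nhds (hstar u hu))).star_star
      rw [star_star] at h2
      exact h2.differentiableWithinAt
    exact h1.comp (f := fun p : (ℂ × ℂ) × (ℂ × ℂ) => p.1) differentiableOn_fst fun p hp => hp.1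
  have hd2 : DifferentiableOn ℂ (fun p : (ℂ × ℂ) × (ℂ × ℂ) => φ p.2) (bidisk ×ˢ bidisk) :=
    hφ.comp (f := fun p : (ℂ × ℂ) × (ℂ × ℂ) => p.2) differentiableOn_snd fun p hp => hp.2
  have hne : ∀ a b : ℂ, ‖a‖ < 1 → ‖b‖ < 1 → 1 - a * b ≠ 0 := fun a b ha hb => by
    simpa using one_sub_mul_conj_ne_zero (b := conj b) ha (by simpa using hb.le)
  have hd3 : DifferentiableOn ℂ (fun p : (ℂ × ℂ) × (ℂ × ℂ) =>
      (1 - p.2.1 * p.1.1) * (1 - p.2.2 * p.1.2)) (bidisk ×ˢ bidisk) := by fun_prop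
  have hd4 : DifferentiableOn ℂ (fun p : (ℂ × ℂ) × (ℂ × ℂ) =>
      1 / ((1 - p.2.1 * p.1.1) * (1 - p.2.2 * p.1.2))) (bidisk ×ˢ bidisk) := by
    simp only [one_div]
    exact hd3.inv fun p hp => mul_ne_zero (hne _ _ hp.2.1 hp.1.1) (hne _ _ hp.2.2 hp.1.2)
  have hF : DifferentiableOn ℂ F (bidisk ×ˢ bidisk) := by
    refine ((((differentiableOn_const _).sub (hd1.const_mul α)).mul
      ((differentiableOn_const _).sub (hd2.const_mul _))).mul
      differentiableOn_integral_cauchyMap_mul).sub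
      (((differentiableOn_const _).sub (hd2.mul hd1)).mul hd4)
  have hFeq : ∀ w ∈ bidisk, ∀ v ∈ bidisk, F ((conj w.1, conj w.2), v) =
      (1 - α * conj (φ w)) * (1 - conj α * φ v) *
        (∫ θ, szego w (torusPt θ) * szego (torusPt θ) v ∂σ) -
      (1 - φ v * conj (φ w)) * szego w v := by
    intro w hw v hv
    have h1 : star ((conj w.1, conj w.2) : ℂ × ℂ) = w := star_star w
    simp only [hFdef, h1, cauchyMap_coord_conj hw, cauchyMap_star_coord hv]
    rfl
  have hdiag : ∀ w ∈ bidisk, F ((conj w.1, conj w.2), w) = 0 := by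
    intro w hw
    rw [hFeq w hw w hw]
    have hp := congrArg (fun x : ℝ => (x : ℂ)) (hσ.poisson w hw)
    rw [← integral_complex_ofReal] at hp
    simp_rw [poissonDisk_mul_poissonDisk] at hp
    rw [integral_const_mul] at hp
    set I := ∫ θ, szego w (torusPt θ) * szego (torusPt θ) w ∂σ
    have hsq : ∀ a : ℂ, ((‖a‖ : ℝ) : ℂ) ^ 2 = a * conj a := fun a => by
      rw [Complex.mul_conj, Complex.normSq_eq_norm_sq]; push_cast; rfl
    have hden : (1 - α * conj (φ w)) * (1 - conj α * φ w) =
        (α - φ w) * conj (α - φ w) := by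
      rw [map_sub]
      linear_combination -(1 - φ w * conj (φ w)) * hα2
    have hαφ : (α - φ w) * conj (α - φ w) ≠ 0 := by
      have : α - φ w ≠ 0 := fun h0 => by
        have h1 := hφ1 w hw
        rw [← sub_eq_zero.mp h0, hα] at h1
        exact lt_irrefl _ h1
      exact mul_ne_zero this ((map_ne_zero _).mpr this)
    have hw1 : 1 - w.1 * conj w.1 ≠ 0 := one_sub_mul_conj_ne_zero hw.1 hw.1.le
    have hw2 : 1 - w.2 * conj w.2 ≠ 0 := one_sub_mul_conj_ne_zero hw.2 hw.2.le
    push_cast at hp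
    rw [hsq, hsq, hsq, hsq, div_eq_iff hαφ] at hp
    rw [hden, szego, sub_eq_zero, mul_one_div, eq_div_iff (mul_ne_zero hw1 hw2), hp]
    ring
  have h := eq_zero_of_eq_zero_on_antidiagonal_bidisk hF hdiag (conj_mem_bidisk hw) hv
  rw [hFeq w hw v hv] at h
  exact sub_eq_zero.mp h

theorem IsClarkMeasure.ne_zero {φ : ℂ × ℂ → ℂ} (h0 : φ (0, 0) = 0) {α : ℂ} (hα : ‖α‖ = 1)
    {σ : Measure Torus} (hσ : IsClarkMeasure φ α σ) : σ ≠ 0 := by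
  rintro rfl
  have h := hσ.poisson (0, 0) ⟨by simp, by simp⟩
  simp [h0, hα] at h

/-- Were there no embedding, the default value `0` could not be surjective, as `L²(σ) ≠ 0` for `σ ≠
0`. -/
theorem isClarkEmbedding_clarkEmbedding {φ : ℂ × ℂ → ℂ} {α : ℂ} {σ : Measure Torus}
    [IsFiniteMeasure σ] (hσ : σ ≠ 0) (hJ : Function.Surjective (clarkEmbedding φ α σ)) :
    IsClarkEmbedding φ α σ (clarkEmbedding φ α σ) := by
  by_cases h : ∃ J, IsClarkEmbedding φ α σ J
  · rw [clarkEmbedding, dif_pos h]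
    exact h.choose_spec
  · exfalso
    rw [clarkEmbedding, dif_neg h] at hJ
    obtain ⟨f, hf⟩ := hJ (Lp.const 2 σ (1 : ℂ))
    have : NeZero σ := ⟨hσ⟩
    have h1 := Lp.coeFn_const (p := 2) (μ := σ) (1 : ℂ)
    rw [← hf, _root_.zero_apply] at h1
    obtain ⟨θ, h2, h3⟩ := (h1.and (Lp.coeFn_zero ℂ 2 σ)).exists
    rw [h3] at h2
    simp at h2

/-! ### Reproducing kernels of model spaces -/

/-- The kernel is continuous on the closed bidisk, so it is bounded and has its boundary values as
radial limits. -/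
theorem hardyEval_szegoL2 {w z : ℂ × ℂ} (hw : w ∈ bidisk) (hz : z ∈ bidisk) :
    hardyEval (szegoL2 w) z = szego w z := by
  have hset : {z : ℂ × ℂ | ‖z.1‖ ≤ 1 ∧ ‖z.2‖ ≤ 1} = Metric.closedBall 0 1 := by
    ext z
    simp [Prod.norm_def]
  have hc : ContinuousOn (szego w) {z : ℂ × ℂ | ‖z.1‖ ≤ 1 ∧ ‖z.2‖ ≤ 1} := by
    have h1 : ContinuousOn (fun z => szego z w) {z : ℂ × ℂ | ‖z.1‖ ≤ 1 ∧ ‖z.2‖ ≤ 1} :=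
      continuousOn_szego.comp (f := fun z => (z, w)) (by fun_prop) fun z hz => ⟨hz, hw⟩
    refine (Complex.continuous_conj.comp_continuousOn h1).congr fun z _ => ?_
    exact (conj_szego z w).symm
  obtain ⟨C, hC⟩ := (hset ▸ isCompact_closedBall (0 : ℂ × ℂ) 1 :
    IsCompact {z : ℂ × ℂ | ‖z.1‖ ≤ 1 ∧ ‖z.2‖ ≤ 1}).exists_bound_of_continuousOn hc
  have hd : DifferentiableOn ℂ (szego w) bidisk := by
    unfold szego
    simp only [one_div]
    have hd : DifferentiableOn ℂ (fun z : ℂ × ℂ => (1 - z.1 * conj w.1) * (1 - z.2 * conj w.2))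
      bidisk := by fun_prop
    refine hd.inv fun z hz => mul_ne_zero ?_ ?_
    · exact one_sub_mul_conj_ne_zero hz.1 hw.1.le
    · exact one_sub_mul_conj_ne_zero hz.2 hw.2.le
  refine (hardy_of_radial_limit hd (C := C) (fun z hz => hC z ⟨hz.1.le, hz.2.le⟩) ?_).2 z hz
  filter_upwards [coeFn_szegoL2 hw] with θ hθ
  rw [hθ]
  refine ((hc (torusPt θ) ⟨(norm_torusPt_fst θ).le, (norm_torusPt_snd θ).le⟩).tendsto).comp
    (tendsto_nhdsWithin_iff.mpr ⟨tendsto_smul_nhdsLT_one _, ?_⟩)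
  filter_upwards [eventually_mem_Ioo_nhdsLT_one] with r hr
  have := smul_torusPt_mem_bidisk hr.1.le hr.2 θ
  exact ⟨this.1.le, this.2.le⟩

theorem szegoL2_mem_hardyTwo {a : ℂ} (ha : ‖a‖ < 1) : szegoL2 (0, a) ∈ hardyTwo := by
  have hw : ((0 : ℂ), a) ∈ bidisk := ⟨by simp, ha⟩
  have hg := szegoL2_mem_hardy hw
  have hP : hardyTwo.starProjection (szegoL2 (0, a)) ∈ hardyTwo :=
    Submodule.starProjection_apply_mem _ _
  have hA := backwardShiftL2_mem_hardy hg
  have hsum : ∀ z ∈ bidisk, szego (0, a) z =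
      hardyEval (hardyTwo.starProjection (szegoL2 (0, a))) z +
        z.1 * hardyEval (backwardShiftL2 (szegoL2 (0, a))) z := by
    intro z hz
    rw [← hardyEval_szegoL2 hw hz, ← hardyEval_mulZ1 hA hz, ← hardyEval_add _ _ hz,
      starProjection_hardyTwo_add_mulZ1]
  rw [eq_of_hardyEval_eq hg (hardyTwo_le_hardy hP) fun z hz => ?_]
  · exact hP
  have hz' : ((0 : ℂ), z.2) ∈ bidisk := ⟨by simp, hz.2⟩
  have h0 := hsum _ hz'
  rw [zero_mul, add_zero, ← hardyEval_hardyTwo hP hz] at h0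
  rw [hardyEval_szegoL2 hw hz, ← h0]
  simp [szego]

/-- The reproducing kernel `k_w^φ` as an element of `L²` of the torus. -/
noncomputable def modelKernel (φ : ℂ × ℂ → ℂ) (w : ℂ × ℂ) : L2Torus :=
  szegoL2 w - conj (φ w) • innerMul φ (szegoL2 w)

theorem modelKernel_mem_modelSpace {φ : ℂ × ℂ → ℂ} (hφ : IsInner φ) {w : ℂ × ℂ}
    (hw : w ∈ bidisk) : modelKernel φ w ∈ modelSpace φ := by
  have hk := szegoL2_mem_hardy hw
  refine (mem_modelSpace_iff hφ).mpr
    ⟨sub_mem hk (Submodule.smul_mem _ _ (hφ.innerMul_mem_hardy hk)), fun g hg => ?_⟩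
  rw [modelKernel, inner_sub_right, inner_smul_right, hφ.inner_innerMul, ← inner_conj_symm,
    inner_szegoL2 hw, ← inner_conj_symm g, inner_szegoL2 hw, hφ.hardyEval_innerMul hg hw, map_mul,
    sub_self]

theorem hardyEval_modelKernel {φ : ℂ × ℂ → ℂ} (hφ : IsInner φ) {w z : ℂ × ℂ} (hw : w ∈ bidisk)
    (hz : z ∈ bidisk) :
    hardyEval (modelKernel φ w) z = (1 - φ z * conj (φ w)) * szego w z := by
  rw [modelKernel, ← inner_szegoL2 hz, inner_sub_right, inner_smul_right, inner_szegoL2 hz,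
    inner_szegoL2 hz, hφ.hardyEval_innerMul (szegoL2_mem_hardy hw) hz, hardyEval_szegoL2 hw hz]
  ring

theorem inner_modelKernel {φ : ℂ × ℂ → ℂ} (hφ : IsInner φ) {w : ℂ × ℂ} (hw : w ∈ bidisk)
    {f : L2Torus} (hf : f ∈ modelSpace φ) : ⟪modelKernel φ w, f⟫_ℂ = hardyEval f w := by
  rw [modelKernel, inner_sub_left, inner_smul_left, inner_szegoL2 hw,
    ((mem_modelSpace_iff hφ).mp hf).2 _ (szegoL2_mem_hardy hw), mul_zero, sub_zero]

/-- Kernels with `w₁ ≠ 0` suffice by continuity; this allows cancelling `conj w₁` in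
`IsClarkEmbedding.comp_clarkUnitary`. -/
theorem eq_zero_of_inner_modelKernel {φ : ℂ × ℂ → ℂ} (hφ : IsInner φ) {f : L2Torus}
    (hf : f ∈ modelSpace φ)
    (h : ∀ w ∈ bidisk, w.1 ≠ 0 → ⟪modelKernel φ w, f⟫_ℂ = 0) : f = 0 := by
  have h1 : ∀ w ∈ bidisk, w.1 ≠ 0 → hardyEval f w = 0 := fun w hw hw1 => by
    rw [← inner_modelKernel hφ hw hf, h w hw hw1]
  refine eq_zero_of_hardyEval_eq_zero (mem_hardy_of_mem_modelSpace hf) fun z hz => ?_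
  by_cases hz1 : z.1 = 0
  · have hc : ContinuousAt (fun s : ℂ => hardyEval f (s, z.2)) 0 := by
      have h2 : ContinuousAt (hardyEval f) ((0 : ℂ), z.2) :=
        (differentiableOn_hardyEval f).continuousOn.continuousAt
          (isOpen_bidisk.mem_nhds ⟨by simp, hz.2⟩)
      exact ContinuousAt.comp (f := fun s : ℂ => (s, z.2)) h2 (by fun_prop)
    have h3 : Tendsto (fun s : ℂ => hardyEval f (s, z.2)) (𝓝[≠] 0) (𝓝 (hardyEval f (0, z.2))) :=
      hc.tendsto.mono_left nhdsWithin_le_nhds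
    have h4 : z = (0, z.2) := Prod.ext hz1 rfl
    rw [h4]
    refine tendsto_nhds_unique_of_eventuallyEq h3 tendsto_const_nhds ?_
    filter_upwards [self_mem_nhdsWithin, nhdsWithin_le_nhds (Metric.ball_mem_nhds (0 : ℂ) one_pos)]
      with s hs hs'
    exact h1 (s, z.2) ⟨by simpa using hs', hz.2⟩ hs
  · exact h1 z hz hz1

theorem dense_span_modelKernel {φ : ℂ × ℂ → ℂ} (hφ : IsInner φ) :
    Dense (Submodule.span ℂ {k : modelSpace φ | ∃ w ∈ bidisk, w.1 ≠ 0 ∧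
      (k : L2Torus) = modelKernel φ w} : Set (modelSpace φ)) := by
  rw [Submodule.dense_iff_topologicalClosure_eq_top, Submodule.topologicalClosure_eq_top_iff,
    Submodule.eq_bot_iff]
  intro f hf
  refine Subtype.ext (eq_zero_of_inner_modelKernel hφ f.2 fun w hw hw1 => ?_)
  exact hf ⟨modelKernel φ w, modelKernel_mem_modelSpace hφ hw⟩
    (Submodule.subset_span ⟨w, hw, hw1, rfl⟩)

/-- With `t = ψ(z) conj ψ(w)` and `a = z₁ conj w₁`, it is `1 - a t = (1 - t) + t (1 - a)`; the
factor `1 - a` cancels the first Cauchy factor of `k_w`. -/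
theorem modelKernel_decomposition {φ ψ : ℂ × ℂ → ℂ} (hφ : IsInner φ) (hψ : IsInner ψ)
    (hmul : ∀ z ∈ bidisk, φ z = z.1 * ψ z) {w : ℂ × ℂ} (hw : w ∈ bidisk) :
    modelKernel φ w = modelKernel ψ w + innerMul ψ (conj (ψ w) • szegoL2 (0, w.2)) := by
  have hw' : ((0 : ℂ), w.2) ∈ bidisk := ⟨by simp, hw.2⟩
  rw [eq_add_innerMul_iff hψ
    (mem_hardy_of_mem_modelSpace (modelKernel_mem_modelSpace hφ hw))
    (mem_hardy_of_mem_modelSpace (modelKernel_mem_modelSpace hψ hw))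
    (Submodule.smul_mem _ _ (szegoL2_mem_hardy hw'))]
  intro z hz
  rw [hardyEval_modelKernel hφ hw hz, hardyEval_modelKernel hψ hw hz, hardyEval_smul,
    hardyEval_szegoL2 hw' hz, hmul z hz, hmul w hw]
  have h1 : 1 - z.1 * conj w.1 ≠ 0 := one_sub_mul_conj_ne_zero hz.1 hw.1.le
  have h2 : 1 - z.2 * conj w.2 ≠ 0 := one_sub_mul_conj_ne_zero hz.2 hw.2.le
  simp only [szego, map_mul, map_zero, mul_zero, sub_zero, one_mul]
  field_simp
  ring

/-- The formula for `U` is applied to the decomposed kernel. Since `φ(0, w₂) = 0`, the kernel `k₀`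
is the Szegő kernel at `(0, w₂)`. -/
theorem conj_fst_smul_clarkUnitary_modelKernel {φ ψ : ℂ × ℂ → ℂ} (hφ : IsInner φ)
    (hψ : IsInner ψ) (hmul : ∀ z ∈ bidisk, φ z = z.1 * ψ z) {α : ℂ} (hα : ‖α‖ = 1)
    {w : ℂ × ℂ} (hw : w ∈ bidisk) {k k₀ : modelSpace φ} (hk : (k : L2Torus) = modelKernel φ w)
    (hk₀ : (k₀ : L2Torus) = modelKernel φ (0, w.2)) :
    conj w.1 • clarkUnitary φ α k = k - (1 - α * conj (φ w)) • k₀ := by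
  have hw' : ((0 : ℂ), w.2) ∈ bidisk := ⟨by simp, hw.2⟩
  have hψk := modelKernel_mem_modelSpace hψ hw
  have hs : conj (ψ w) • szegoL2 (0, w.2) ∈ hardyTwo :=
    Submodule.smul_mem _ _ (szegoL2_mem_hardyTwo hw.2)
  have hdec : (k : L2Torus) = modelKernel ψ w + innerMul ψ (conj (ψ w) • szegoL2 (0, w.2)) := by
    rw [hk, modelKernel_decomposition hφ hψ hmul hw]
  have hcu := coe_clarkUnitary hφ hψ hmul hα k hψk hs hdec
  refine Subtype.ext (eq_of_hardyEval_eq (mem_hardy_of_mem_modelSpace (Subtype.coe_prop _))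
    (mem_hardy_of_mem_modelSpace (Subtype.coe_prop _)) fun z hz => ?_)
  rw [Submodule.coe_smul, hcu, Submodule.coe_sub, Submodule.coe_smul, hk, hk₀, hardyEval_smul,
    hardyEval_add _ _ hz, hardyEval_mulZ1 (mem_hardy_of_mem_modelSpace hψk) hz, hardyEval_smul,
    hardyEval_smul, hardyEval_szegoL2 hw' hz, hardyEval_modelKernel hψ hw hz,
    sub_eq_add_neg (modelKernel φ w), ← neg_smul, hardyEval_add _ _ hz, hardyEval_smul,
    hardyEval_modelKernel hφ hw hz, hardyEval_modelKernel hφ hw' hz, hmul z hz, hmul w hw,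
    hmul _ hw']
  have h1 : 1 - z.1 * conj w.1 ≠ 0 := one_sub_mul_conj_ne_zero hz.1 hw.1.le
  have h2 : 1 - z.2 * conj w.2 ≠ 0 := one_sub_mul_conj_ne_zero hz.2 hw.2.le
  rw [mul_comm] at h1 h2
  simp only [szego, map_mul, map_zero, mul_zero, sub_zero, one_mul, zero_mul, mul_comm z.1,
    mul_comm z.2]
  field_simp
  ring

/-! ### The Clark embedding -/

namespace IsClarkEmbedding

variable {φ ψ : ℂ × ℂ → ℂ} {α : ℂ} {σ : Measure Torus} {J : modelSpace φ →L[ℂ] Lp ℂ 2 σ}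

theorem coeFn_apply (hJ : IsClarkEmbedding φ α σ J) (hφ : IsInner φ) {w : ℂ × ℂ}
    (hw : w ∈ bidisk) {k : modelSpace φ} (hk : (k : L2Torus) = modelKernel φ w) :
    J k =ᵐ[σ] fun θ => (1 - α * conj (φ w)) * szego w (torusPt θ) := by
  obtain ⟨k', hk', h⟩ := hJ w hw
  have : k' = k := Subtype.ext (eq_of_hardyEval_eq (mem_hardy_of_mem_modelSpace k'.2)
    (mem_hardy_of_mem_modelSpace k.2) fun z hz => by
      rw [hk' z hz, hk, hardyEval_modelKernel hφ hw hz])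
  rwa [this] at h

/-- The kernels span a dense subspace, and `J` preserves their inner products by the polarized Clark
identity. -/
theorem adjoint_comp_self (hJ : IsClarkEmbedding φ α σ J) (hφ : IsInner φ)
    (hφ1 : ∀ z ∈ bidisk, ‖φ z‖ < 1) (hα : ‖α‖ = 1) (hσ : IsClarkMeasure φ α σ) :
    ContinuousLinearMap.adjoint J ∘L J = ContinuousLinearMap.id ℂ (modelSpace φ) := by
  refine ContinuousLinearMap.ext_on (dense_span_modelKernel hφ) ?_
  rintro k ⟨w, hw, -, hk⟩
  change ContinuousLinearMap.adjoint J (J k) = k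
  rw [← sub_eq_zero]
  refine Subtype.ext (eq_zero_of_inner_modelKernel hφ (Subtype.coe_prop _) fun v hv _ => ?_)
  set l : modelSpace φ := ⟨modelKernel φ v, modelKernel_mem_modelSpace hφ hv⟩
  change ⟪l, ContinuousLinearMap.adjoint J (J k) - k⟫_ℂ = 0
  have hlk : ⟪l, k⟫_ℂ = (1 - φ v * conj (φ w)) * szego w v := by
    rw [Submodule.coe_inner, hk]
    exact (inner_modelKernel hφ hv (modelKernel_mem_modelSpace hφ hw)).trans
      (hardyEval_modelKernel hφ hw hv)
  rw [inner_sub_right, ContinuousLinearMap.adjoint_inner_right, hlk, L2.inner_def,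
    ← hσ.integral_szego_mul_szego hφ.differentiableOn hφ1 hα hw hv, ← integral_const_mul,
    sub_eq_zero]
  refine integral_congr_ae ?_
  filter_upwards [hJ.coeFn_apply hφ hw hk, hJ.coeFn_apply hφ hv (k := l) rfl] with θ h1 h2
  rw [h1, h2, RCLike.inner_apply, map_mul, conj_szego, map_sub, map_one, map_mul,
    Complex.conj_conj]
  ring

/-- On kernels, after multiplication by `conj w₁`, the claim is `k_w - k_{(0,w₂)} = conj w₁ ζ₁ k_w`
on the torus, times `1 - α conj φ(w)`. -/
theorem comp_clarkUnitary (hJ : IsClarkEmbedding φ α σ J) (hφ : IsInner φ) (hψ : IsInner ψ)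
    (hmul : ∀ z ∈ bidisk, φ z = z.1 * ψ z) (hα : ‖α‖ = 1) :
    J ∘L clarkUnitary φ α = mulZ1 σ ∘L J := by
  refine ContinuousLinearMap.ext_on (dense_span_modelKernel hφ) ?_
  rintro k ⟨w, hw, hw1, hk⟩
  have hw' : ((0 : ℂ), w.2) ∈ bidisk := ⟨by simp, hw.2⟩
  set k₀ : modelSpace φ := ⟨modelKernel φ (0, w.2), modelKernel_mem_modelSpace hφ hw'⟩
  change J (clarkUnitary φ α k) = mulZ1 σ (J k)
  refine smul_right_injective _ ((map_ne_zero conj).mpr hw1) ?_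
  change conj w.1 • J (clarkUnitary φ α k) = conj w.1 • mulZ1 σ (J k)
  rw [← map_smul, conj_fst_smul_clarkUnitary_modelKernel hφ hψ hmul hα hw hk (k₀ := k₀) rfl,
    map_sub, map_smul]
  refine Lp.ext ?_
  filter_upwards [Lp.coeFn_sub (J k) ((1 - α * conj (φ w)) • J k₀),
    Lp.coeFn_smul (1 - α * conj (φ w)) (J k₀), Lp.coeFn_smul (conj w.1) (mulZ1 σ (J k)),
    coeFn_mulZ1 (J k), hJ.coeFn_apply hφ hw hk, hJ.coeFn_apply hφ hw' (k := k₀) rfl]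
    with θ h1 h2 h3 h4 h5 h6
  rw [h1, Pi.sub_apply, h2, h3, Pi.smul_apply, Pi.smul_apply, h4, h5, h6, hmul _ hw']
  have hconj : ∀ a b : ℂ, ‖a‖ = 1 → ‖b‖ < 1 → 1 - a * conj b ≠ 0 := fun a b ha hb h0 =>
    one_sub_mul_conj_ne_zero hb ha.le (by
      have := congrArg conj h0
      simpa [mul_comm] using this)
  have h7 := hconj _ _ (norm_torusPt_fst θ) hw.1
  have h8 := hconj _ _ (norm_torusPt_snd θ) hw.2
  simp only [szego, smul_eq_mul, map_zero, mul_zero, sub_zero, one_mul, zero_mul]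
  field_simp
  ring

end IsClarkEmbedding

theorem mainTheorem7 (φ : ℂ × ℂ → ℂ) (hφ : IsInner φ) (α : ℂ) (hα : ‖α‖ = 1)
    (σ : Measure Torus) (hσ : IsClarkMeasure φ α σ)
    (hJ : Function.Surjective (clarkEmbedding φ α σ))
    (hbdd : ∃ C : ℝ, ∀ z ∈ bidisk, ‖oneAlpha φ α z‖ ≤ C)
    (hzero : ∀ z₂ : ℂ, ‖z₂‖ < 1 → φ (0, z₂) = 0) :
    (∃ ψ : ℂ × ℂ → ℂ, IsInner ψ ∧ ∀ z ∈ bidisk, φ z = z.1 * ψ z) ∧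
    (∀ ψ : ℂ × ℂ → ℂ, IsInner ψ → (∀ z ∈ bidisk, φ z = z.1 * ψ z) →
      (modelSpace ψ ⟂ mulSubspace ψ hardyTwo ∧
        modelSpace ψ ⊔ mulSubspace ψ hardyTwo = modelSpace φ) ∧
      (∀ f : modelSpace φ, ∃! p : modelSpace ψ × hardyTwo, ∀ z ∈ bidisk,
        hardyEval f z = hardyEval p.1 z + ψ z * hardyEval p.2 z) ∧
      (∀ (f : modelSpace φ) (f₁ : modelSpace ψ) (f₂ : hardyTwo),
        (∀ z ∈ bidisk, hardyEval f z = hardyEval f₁ z + ψ z * hardyEval f₂ z) →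
        ∀ z ∈ bidisk,
          hardyEval (clarkUnitary φ α f) z = z.1 * hardyEval f₁ z + α * hardyEval f₂ z)) ∧
    clarkUnitary φ α ∈ unitary (modelSpace φ →L[ℂ] modelSpace φ) ∧
    mulZ1 σ = clarkEmbedding φ α σ ∘L clarkUnitary φ α ∘L
      ContinuousLinearMap.adjoint (clarkEmbedding φ α σ) ∧
    clarkUnitary φ α = ContinuousLinearMap.adjoint (clarkEmbedding φ α σ) ∘L mulZ1 σ ∘L
      clarkEmbedding φ α σ ∧
    ¬ FiniteDimensional ℂ
      (LinearMap.range (clarkUnitary φ α - compressedShift φ).toLinearMap) := by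
  obtain ⟨ψ, hψ, hmul⟩ := hφ.exists_eq_mul hα hbdd hzero
  have hfin := hσ.finite
  -- Strictness keeps `α - φ` away from zero in the Clark identity; it comes from the factor `z₁`.
  have hφ1 : ∀ z ∈ bidisk, ‖φ z‖ < 1 := fun z hz => by
    rw [hmul z hz, norm_mul]
    exact (mul_le_of_le_one_right (norm_nonneg _) (hψ.norm_le_one hz)).trans_lt hz.1
  have hJ' := isClarkEmbedding_clarkEmbedding (hσ.ne_zero (hzero 0 (by simp)) hα) hJ
  set J := clarkEmbedding φ α σ
  set U := clarkUnitary φ α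
  have hJJ : ∀ f, ContinuousLinearMap.adjoint J (J f) = f := fun f =>
    congrArg (fun T : modelSpace φ →L[ℂ] modelSpace φ => T f)
      (hJ'.adjoint_comp_self hφ hφ1 hα hσ)
  -- A surjective isometry is unitary; this is the only use of surjectivity beyond excluding the
  -- default value of `clarkEmbedding`.
  have hJJ' : ∀ g, J (ContinuousLinearMap.adjoint J g) = g := fun g => by
    obtain ⟨f, rfl⟩ := hJ g
    rw [hJJ]
  have hJU : ∀ f, J (U f) = mulZ1 σ (J f) := fun f =>
    congrArg (fun T : modelSpace φ →L[ℂ] Lp ℂ 2 σ => T f)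
      (hJ'.comp_clarkUnitary hφ hψ hmul hα)
  have hU : U = ContinuousLinearMap.adjoint J ∘L mulZ1 σ ∘L J :=
    ContinuousLinearMap.ext fun f => by
      change U f = ContinuousLinearMap.adjoint J (mulZ1 σ (J f))
      rw [← hJU, hJJ]
  refine ⟨⟨ψ, hψ, hmul⟩, fun ψ hψ hmul => ⟨⟨isOrtho_modelSpace_mulSubspace hψ,
    modelSpace_sup_mulSubspace hφ hψ hmul⟩, existsUnique_modelSpace_hardyTwo hφ hψ hmul,
    fun f f₁ f₂ hf z hz => hardyEval_clarkUnitary hφ hψ hmul hα f f₁ f₂ hf hz⟩, ?_, ?_, hU,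
    not_finiteDimensional_range_clarkUnitary_sub hφ hψ hmul hα⟩
  · have hadj : ContinuousLinearMap.adjoint U =
        ContinuousLinearMap.adjoint J ∘L ContinuousLinearMap.adjoint (mulZ1 σ) ∘L J := by
      rw [hU, ContinuousLinearMap.adjoint_comp, ContinuousLinearMap.adjoint_comp,
        ContinuousLinearMap.adjoint_adjoint, ContinuousLinearMap.comp_assoc]
    rw [Unitary.mem_iff, ContinuousLinearMap.star_eq_adjoint, hadj]
    constructor
    · refine ContinuousLinearMap.ext fun f => ?_
      change ContinuousLinearMap.adjoint J (ContinuousLinearMap.adjoint (mulZ1 σ) (J (U f))) = f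
      rw [hJU, adjoint_mulZ1_mulZ1, hJJ]
    · refine ContinuousLinearMap.ext fun f => ?_
      change U (ContinuousLinearMap.adjoint J (ContinuousLinearMap.adjoint (mulZ1 σ) (J f))) = f
      rw [← hJJ (U _), hJU, hJJ', mulZ1_adjoint_mulZ1, hJJ]
  · refine ContinuousLinearMap.ext fun g => ?_
    change mulZ1 σ g = J (U (ContinuousLinearMap.adjoint J g))
    rw [hJU, hJJ']
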